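/- Let $\beta=1,2,4$ correspond to $\mathbb F=\mathbb R,\mathbb C,\mathbb H$ respectively, and let $X$ be a random $N\times N$ matrix over $\mathbb F$ whose rows $\mathbf x_1,\dots,\mathbf x_N$ are independent. Each row is regarded as a vector in $\mathbb R^{\beta N}$ with squared length $|\mathbf x|^2=\sum_j|x_j|^2$, and densities are with respect to Lebesgue measure on $\mathbb R^{\beta N}$. Write $(c)_a=\Gamma(c+a)/\Gamma(c)$. For $\mathbb F=\mathbb R,\mathbb C$, $|\det X|$ is the modulus of the usual determinant. For $\mathbb F=\mathbb H$, $|\det X|=|\det\nolimits_{\mathbb C}\hat X|^{1/2}$, where $\hat X$ is the $2N\times 2N$ complex matrix obtained from $X$ by replacing each entry $z+wj$ ($z,w\in\mathbb C$) by the block $\begin{bmatrix} z& w\\ -\bar w&\bar z\end{bmatrix}$. Let $\chi^2_k$ be the chi-squared distribution with $k$ degrees of freedom, $\mathrm{Beta}[a,b]$ the beta distribution on $(0,1)$ with parameters $a,b$, and $\mathrm{BetaP}[a,b]$ the distribution on $(0,\infty)$ with density proportional to $y^{a-1}(1+y)^{-(a+b)}$. In the distributional identities below, the factors of each product are independent.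 In the moment formulas $\alpha\in\mathbb C$ satisfies $\operatorname{Re}\alpha>-\beta/2$; under the stated conditions on $\alpha$ the variable $|\det X|^{2\alpha}$ is integrable. (Gaussian) If row $l$ has density $(2\pi\sigma_l^2)^{-\beta N/2}e^{-|\mathbf x|^2/2\sigma_l^2}$ with $\sigma_l>0$ for each $l$, then $$\big\langle|\det X|^{2\alpha}\big\rangle=\prod_{l=1}^N(2\sigma_l^2)^\alpha\,\big(\beta(N-l+1)/2\big)_\alpha,\qquad |\det X|^2\overset{d}{=}\prod_{l=1}^N\sigma_l^2\,\chi^2_{\beta l}.$$ (Beta type I) If row $l$ has density $\pi^{-\beta N/2}(\beta\nu_l/2)_{\beta N/2}(1-|\mathbf x|^2)^{\beta\nu_l/2-1}$ on the unit ball $|\mathbf x|<1$ (and zero elsewhere) with $\nu_l>0$ for each $l$, then $$\big\langle|\det X|^{2\alpha}\big\rangle=\prod_{l=1}^N\frac{(\beta(N-l+1)/2)_\alpha}{(\beta(N+\nu_l)/2)_\alpha},\qquad |\det X|^2\overset{d}{=}\prod_{l=1}^N\mathrm{Beta}\big[\beta(N-l+1)/2,\ \beta(\nu_l+l-1)/2\big].$$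 (Beta type II) If row $l$ has density $\pi^{-\beta N/2}(\beta\omega_l/2)_{\beta N/2}(1+|\mathbf x|^2)^{-\beta(N+\omega_l)/2}$ with $\omega_l>0$ for each $l$, then, provided also $\operatorname{Re}\alpha<\beta\omega_l/2$ for all $l$ in the moment formula, $$\big\langle|\det X|^{2\alpha}\big\rangle=\prod_{l=1}^N\big(\beta(N-l+1)/2\big)_\alpha\,\big(\beta\omega_l/2\big)_{-\alpha},\qquad |\det X|^2\overset{d}{=}\prod_{l=1}^N\mathrm{BetaP}\big[\beta(N-l+1)/2,\ \beta\omega_l/2\big].$$ -/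

import Mathlib

open MeasureTheory ProbabilityTheory
open scoped Quaternion

/-- The Borel sigma-algebra on the (real) quaternions. -/
noncomputable instance quaternionMeasurableSpace : MeasurableSpace ℍ[ℝ] := borel ℍ[ℝ]

instance quaternionBorelSpace : BorelSpace ℍ[ℝ] := ⟨rfl⟩

/-- The three number systems. -/
inductive NumberSystem where
  | real
  | complex
  | quaternion

namespace NumberSystem

/-- The underlying set of scalars: `ℝ`, `ℂ` or `ℍ`. -/
abbrev Carrier : NumberSystem → Type
  | real => ℝ
  | complex => ℂ
  | quaternion => ℍ[ℝ]

/-- The Dyson index `β = 1, 2, 4`: the number of real components of a scalar. -/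
def beta : NumberSystem → ℕ
  | real => 1
  | complex => 2
  | quaternion => 4

/-- The modulus of a scalar. -/
noncomputable instance instNormCarrier : (F : NumberSystem) → Norm F.Carrier
  | real => inferInstanceAs (Norm ℝ)
  | complex => inferInstanceAs (Norm ℂ)
  | quaternion => inferInstanceAs (Norm ℍ[ℝ])

/-- Scalars carry the Lebesgue measure of their `β` real components.  (On `ℍ` this is the volume of
the Euclidean space with orthonormal basis `1, i, j, k`.) -/
noncomputable instance instMeasureSpaceCarrier : (F : NumberSystem) → MeasureSpace F.Carrier
  | real => inferInstanceAs (MeasureSpace ℝ)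
  | complex => inferInstanceAs (MeasureSpace ℂ)
  | quaternion => inferInstanceAs (MeasureSpace ℍ[ℝ])

end NumberSystem

/-- The `2 × 2` complex block `[z, w; -conj w, conj z]` of the quaternion `z + w j`, where
`z = x + i y` and `w = u + i v`, i.e. of the quaternion `x + y i + u j + v k`. -/
noncomputable def quaternionBlock (q : ℍ[ℝ]) : Matrix (Fin 2) (Fin 2) ℂ :=
  !![⟨q.re, q.imI⟩, ⟨q.imJ, q.imK⟩;
    -(starRingEnd ℂ) ⟨q.imJ, q.imK⟩, (starRingEnd ℂ) ⟨q.re, q.imI⟩]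

/-- An `N × N` quaternion matrix regarded as a `2N × 2N` complex matrix, blockwise. -/
noncomputable def quaternionToComplexMatrix {N : ℕ} (X : Matrix (Fin N) (Fin N) ℍ[ℝ]) :
    Matrix (Fin N × Fin 2) (Fin N × Fin 2) ℂ :=
  Matrix.of fun p q => quaternionBlock (X p.1 q.1) p.2 q.2

namespace NumberSystem

/-- `|det X|`.  For a quaternion matrix it is the square root of the modulus of the determinant of
the associated `2N × 2N` complex matrix: if `X` has a QR decomposition with positive diagonal
entries `r₁, …, r_N` of `R`, then the complex determinant of `Xᴴ X` is `(∏ r_j ^ 2) ^ 2`, whereas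
the quaternion determinant satisfies `|det X| ^ 2 = ∏ r_j ^ 2`. -/
noncomputable def absDet {N : ℕ} :
    (F : NumberSystem) → Matrix (Fin N) (Fin N) F.Carrier → ℝ
  | real => fun X : Matrix (Fin N) (Fin N) ℝ => |X.det|
  | complex => fun X : Matrix (Fin N) (Fin N) ℂ => ‖X.det‖
  | quaternion => fun X : Matrix (Fin N) (Fin N) ℍ[ℝ] =>
      Real.sqrt ‖(quaternionToComplexMatrix X).det‖

/-- The squared Euclidean length `|x|^2` of a row vector. -/
noncomputable def rowNormSq {N : ℕ} (F : NumberSystem) (x : Fin N → F.Carrier) : ℝ :=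
  ∑ j, ‖x j‖ ^ 2

end NumberSystem

/-- `(c)_a = Γ(c + a) / Γ(c)` for real arguments. -/
noncomputable def realPoch (c a : ℝ) : ℝ := Real.Gamma (c + a) / Real.Gamma c

/-- `(c)_a = Γ(c + a) / Γ(c)` for complex arguments. -/
noncomputable def complexPoch (c a : ℂ) : ℂ := Complex.Gamma (c + a) / Complex.Gamma c

namespace NumberSystem

/-- Gaussian row distribution, with density `(2πσ²)^(-βN/2) exp(-|x|²/(2σ²))`. -/
noncomputable def gaussianRow (F : NumberSystem) (N : ℕ) (σ : ℝ) : Measure (Fin N → F.Carrier) :=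
  volume.withDensity fun x => ENNReal.ofReal
    ((2 * Real.pi * σ ^ 2) ^ (-(F.beta * N / 2 : ℝ)) *
      Real.exp (-(F.rowNormSq x) / (2 * σ ^ 2)))

open Classical in
/-- Beta type I row distribution, with density
`π^(-βN/2) (βν/2)_{βN/2} (1 - |x|²)^(βν/2 - 1)` on the unit ball. -/
noncomputable def betaOneRow (F : NumberSystem) (N : ℕ) (ν : ℝ) : Measure (Fin N → F.Carrier) :=
  volume.withDensity fun x => ENNReal.ofReal
    (if F.rowNormSq x < 1 then
      Real.pi ^ (-(F.beta * N / 2 : ℝ)) * realPoch (F.beta * ν / 2) (F.beta * N / 2) *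
        (1 - F.rowNormSq x) ^ (F.beta * ν / 2 - 1 : ℝ)
    else 0)

/-- Beta type II row distribution, with density
`π^(-βN/2) (βω/2)_{βN/2} (1 + |x|²)^(-β(N+ω)/2)`. -/
noncomputable def betaTwoRow (F : NumberSystem) (N : ℕ) (ω : ℝ) : Measure (Fin N → F.Carrier) :=
  volume.withDensity fun x => ENNReal.ofReal
    (Real.pi ^ (-(F.beta * N / 2 : ℝ)) * realPoch (F.beta * ω / 2) (F.beta * N / 2) *
      (1 + F.rowNormSq x) ^ (-(F.beta * (N + ω) / 2 : ℝ)))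

end NumberSystem

/-- The chi-squared distribution with `k > 0` degrees of freedom: density proportional to
`y^(k/2 - 1) exp(-y/2)` on `y > 0`. -/
noncomputable def chiSquaredMeasure (k : ℝ) : Measure ℝ := gammaMeasure (k / 2) (1 / 2)

open Classical in
/-- The beta prime distribution `BetaP[a, b]` with `a, b > 0`: density
`y^(a-1) (1+y)^(-(a+b)) / B(a, b)` on `y > 0`. -/
noncomputable def betaPrimeMeasure (a b : ℝ) : Measure ℝ :=
  volume.withDensity fun y => ENNReal.ofReal
    (if 0 < y then (1 / ProbabilityTheory.beta a b) * y ^ (a - 1) * (1 + y) ^ (-(a + b)) else 0)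

/-!
Condition on the first row `x` and rotate coordinates so that `x` becomes a multiple of the first
basis vector. All row laws are rotation invariant, so the other rows keep their laws, and
`|det X|² = |x|² |det X'|²`, where `X'` consists of the other rows without their first coordinate.
The rows of `X'` are again independent with radial densities, hence by induction `|det X|²` is
distributed as a product of independent variables, the `i`-th one (`i = 0, …, N - 1`) being the
squared length of the last `N - i` coordinates of the `i`-th row (`map_detModulus_sq`).

The three number systems are treated at once, as division rings `K` with a norm coming from a star
structure. The rotation is a Householder reflection
(`exists_householder_vecMul_succ_eq_zero`). Being an involution, it preserves Lebesgue measure and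
has determinant of modulus one. Of `|det|` the argument uses only multiplicativity, measurability
and the expansion along a first row with a single nonzero entry (`IsDetModulus`). The rotation is
chosen for each fixed `x` inside Fubini's theorem, so it need not depend measurably on `x`.

By homogeneity, squared lengths are distributed under Lebesgue measure as a multiple of a power law
`r ^ (p - 1) dr` (`exists_map_eq_smul_powerMeasure`), and each of the three families of densities
is stable under deleting coordinates, up to constants. No constant has to be computed, since a
probability measure is determined by a density up to a factor (`radialLaw_eq_of_proportional`).
The moments follow from the distributional identities and the Mellin transforms of the gamma, beta
and beta prime laws.
-/

/-! ### Householder reflections -/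

section Householder

variable {K : Type*} [NormedDivisionRing K]

/-- The squared Euclidean length of a vector with entries in a normed division ring. -/
def sqLength {n : ℕ} (x : Fin n → K) : ℝ := ∑ j, ‖x j‖ ^ 2

lemma sqLength_nonneg {n : ℕ} (x : Fin n → K) : 0 ≤ sqLength x :=
  Finset.sum_nonneg fun _ _ => sq_nonneg _

lemma sqLength_succ {n : ℕ} (x : Fin (n + 1) → K) :
    sqLength x = ‖x 0‖ ^ 2 + sqLength (fun j => x j.succ) := Fin.sum_univ_succ _

lemma sqLength_eq_zero {n : ℕ} {x : Fin n → K} : sqLength x = 0 ↔ x = 0 := by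
  rw [sqLength, Finset.sum_eq_zero_iff_of_nonneg fun _ _ => sq_nonneg _]
  simp [funext_iff]

variable [StarRing K]

lemma vecMul_vecMulVec_star {n : ℕ} (x v : Fin n → K) :
    Matrix.vecMul x (Matrix.vecMulVec (star v) v) = fun k => (x ⬝ᵥ star v) * v k := by
  ext k
  simp [Matrix.vecMul, dotProduct, Matrix.vecMulVec_apply, Finset.sum_mul, mul_assoc]

variable [NormedAlgebra ℝ K]

/-- The Householder matrix `1 - 2 v* v / |v|²` of a row vector `v`: the reflection that reverses `v`
and fixes its orthogonal complement, acting on row vectors from the right.  It is the identity for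
`v = 0`. -/
noncomputable def householder {n : ℕ} (v : Fin n → K) : Matrix (Fin n) (Fin n) K :=
  1 - (2 / sqLength v) • Matrix.vecMulVec (star v) v

/-- The norm of `K` comes from its star structure: `z z* = |z|²`. -/
class IsStarNorm (K : Type*) [NormedDivisionRing K] [StarRing K] [NormedAlgebra ℝ K] : Prop
    extends StarModule ℝ K where
  mul_star_self : ∀ z : K, z * star z = algebraMap ℝ K (‖z‖ ^ 2)

variable [IsStarNorm K]

lemma dotProduct_star_self {n : ℕ} (x : Fin n → K) :
    x ⬝ᵥ star x = algebraMap ℝ K (sqLength x) := by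
  simp [dotProduct, IsStarNorm.mul_star_self, sqLength]

lemma vecMulVec_star_mul_self {n : ℕ} (v : Fin n → K) :
    Matrix.vecMulVec (star v) v * Matrix.vecMulVec (star v) v =
      sqLength v • Matrix.vecMulVec (star v) v := by
  ext j k
  have : ∑ l, star (v j) * v l * (star (v l) * v k) =
      star (v j) * (v ⬝ᵥ star v) * v k := by
    simp [dotProduct, Finset.sum_mul, Finset.mul_sum, mul_assoc]
  simp only [Matrix.mul_apply, Matrix.vecMulVec_apply, Pi.star_apply, Matrix.smul_apply, this,
    dotProduct_star_self, Algebra.smul_def]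
  rw [← Algebra.commutes, mul_assoc]

lemma householder_mul_self {n : ℕ} (v : Fin n → K) : householder v * householder v = 1 := by
  have h : (2 / sqLength v) * (2 / sqLength v) * sqLength v = 2 * (2 / sqLength v) := by
    by_cases h0 : sqLength v = 0
    · simp [h0]
    · field_simp
  simp only [householder, sub_mul, mul_sub, one_mul, mul_one, smul_mul_smul_comm,
    vecMulVec_star_mul_self, smul_smul, h, two_mul, add_smul]
  abel

lemma conjTranspose_householder {n : ℕ} (v : Fin n → K) :
    (householder v).conjTranspose = householder v := by
  ext j k
  simp [householder, Matrix.conjTranspose_apply, Matrix.vecMulVec_apply, Matrix.one_apply,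
    eq_comm (a := j), apply_ite (star : K → K)]

lemma sqLength_vecMul_householder {n : ℕ} (v y : Fin n → K) :
    sqLength (Matrix.vecMul y (householder v)) = sqLength y := by
  have h : Matrix.vecMul y (householder v) ⬝ᵥ star (Matrix.vecMul y (householder v)) =
      y ⬝ᵥ star y := by
    rw [Matrix.star_vecMul, conjTranspose_householder, ← Matrix.dotProduct_mulVec,
      Matrix.mulVec_mulVec, householder_mul_self, Matrix.one_mulVec]
  rw [dotProduct_star_self, dotProduct_star_self] at h
  exact (algebraMap ℝ K).injective h

/-- Every row vector is mapped to a multiple of the first basis vector by some reflection. -/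
lemma exists_householder_vecMul_succ_eq_zero {n : ℕ} (x : Fin (n + 1) → K) :
    ∃ v : Fin (n + 1) → K, ∀ j : Fin n, Matrix.vecMul x (householder v) j.succ = 0 := by
  -- `x 0 = -‖x 0‖ u` with `u` a unit; the reflection takes `x` to `|x| u e₁`.
  obtain ⟨u, hu, hxu⟩ : ∃ u : K, ‖u‖ = 1 ∧ x 0 = -(‖x 0‖ • u) := by
    by_cases h0 : x 0 = 0
    · exact ⟨1, norm_one, by simp [h0]⟩
    · have h1 : ‖x 0‖ ≠ 0 := norm_ne_zero_iff.2 h0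
      refine ⟨-(‖x 0‖⁻¹ • x 0), ?_, ?_⟩
      · rw [norm_neg, norm_smul, norm_inv, norm_norm, inv_mul_cancel₀ h1]
      · rw [smul_neg, neg_neg, smul_smul, mul_inv_cancel₀ h1, one_smul]
  set m := ‖x 0‖ with hm
  set R := Real.sqrt (sqLength x) with hR
  have hRQ : R ^ 2 = sqLength x := Real.sq_sqrt (sqLength_nonneg x)
  set v : Fin (n + 1) → K := x - Pi.single 0 (R • u) with hv
  have hvs : ∀ j : Fin n, v j.succ = x j.succ := fun j => by simp [hv]
  have hv0 : v 0 = -((m + R) • u) := by simp [hv, hxu, add_smul]; abel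
  have hvQ : sqLength v = 2 * (sqLength x + m * R) := by
    have h1 := sqLength_succ x
    rw [sqLength_succ v, hv0]
    simp only [hvs, norm_neg, norm_smul, hu, mul_one, Real.norm_eq_abs, sq_abs]
    rw [← hm] at h1
    linear_combination hRQ - h1
  have ht : x ⬝ᵥ star v = algebraMap ℝ K (sqLength x + m * R) := by
    have h2 : x 0 * star (R • u) = -algebraMap ℝ K (m * R) := by
      rw [hxu, star_smul, neg_mul, smul_mul_smul_comm, IsStarNorm.mul_star_self, hu,
        Algebra.smul_def]
      simp
    rw [hv, star_sub, dotProduct_sub, dotProduct_star_self, ← Pi.single_star,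
      dotProduct_single, h2]
    simp
  refine ⟨v, fun j => ?_⟩
  rw [householder, Matrix.vecMul_sub, Matrix.vecMul_one, Matrix.vecMul_smul, Pi.sub_apply,
    Pi.smul_apply, vecMul_vecMulVec_star, ht]
  beta_reduce
  rw [hvs, ← Algebra.smul_def, smul_smul]
  -- `|v|² = 2 ⟨x, v⟩`, so the reflection subtracts exactly `v` from `x`.
  by_cases hq : sqLength v = 0
  · have : x j.succ = 0 := by rw [← hvs, sqLength_eq_zero.1 hq]; rfl
    simp [this]
  · have : 2 / sqLength v * (sqLength x + m * R) = 1 := by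
      rw [div_mul_eq_mul_div, ← hvQ, div_self hq]
    rw [this, one_smul, sub_self]

end Householder

/-! ### Reflections preserve volume -/

section Volume

variable {K : Type*} [NormedDivisionRing K] [MeasureSpace K] [BorelSpace K]

lemma measurable_sqLength {n : ℕ} : Measurable (sqLength : (Fin n → K) → ℝ) := by
  unfold sqLength
  fun_prop

variable [StarRing K] [NormedAlgebra ℝ K] [IsStarNorm K] [FiniteDimensional ℝ K]
  [SecondCountableTopology K] [(volume : Measure K).IsAddHaarMeasure]

/-- A reflection is an involution, so its real determinant is `±1`. -/
lemma measurePreserving_vecMul_householder {n : ℕ} (v : Fin n → K) :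
    MeasurePreserving (fun y : Fin n → K => Matrix.vecMul y (householder v)) := by
  let f : (Fin n → K) →ₗ[ℝ] (Fin n → K) :=
    { toFun := fun y => Matrix.vecMul y (householder v)
      map_add' := fun y z => Matrix.add_vecMul _ _ _
      map_smul' := fun c y => Matrix.smul_vecMul _ _ _ }
  have hff : f * f = 1 := by
    refine LinearMap.ext fun y => ?_
    change Matrix.vecMul (Matrix.vecMul y (householder v)) (householder v) = y
    rw [Matrix.vecMul_vecMul, householder_mul_self, Matrix.vecMul_one]
  have hdet : LinearMap.det f * LinearMap.det f = 1 := by rw [← map_mul, hff, map_one]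
  have habs : |LinearMap.det f| = 1 := by
    rcases mul_self_eq_one_iff.1 hdet with h | h <;> simp [h]
  change MeasurePreserving f
  refine ⟨f.continuous_of_finiteDimensional.measurable, ?_⟩
  have hne : LinearMap.det f ≠ 0 := by intro h; simp [h] at habs
  have := Measure.map_linearMap_addHaar_eq_smul_addHaar (volume : Measure (Fin n → K)) hne
  rw [abs_inv, habs] at this
  simpa using this

end Volume

/-! ### Power laws on the half-line -/

section PowerLaw

open scoped ENNReal Pointwise

/-- The measure `r ^ (p - 1) dr` on `(0, ∞)`. -/
noncomputable def powerMeasure (p : ℝ) : Measure ℝ :=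
  (volume.restrict (Set.Ioi 0)).withDensity fun r => ENNReal.ofReal (r ^ (p - 1))

lemma powerMeasure_Iio_of_nonpos (p : ℝ) {b : ℝ} (hb : b ≤ 0) : powerMeasure p (Set.Iio b) = 0 := by
  have : Set.Iio b ∩ Set.Ioi 0 = ∅ := by
    ext x; simp only [Set.mem_inter_iff, Set.mem_Iio, Set.mem_Ioi]
    exact ⟨fun h => by linarith [h.1, h.2], fun h => h.elim⟩
  rw [powerMeasure, withDensity_apply _ measurableSet_Iio,
    Measure.restrict_restrict measurableSet_Iio, this]
  simp

lemma powerMeasure_Iio {p : ℝ} (hp : 0 < p) {b : ℝ} (hb : 0 ≤ b) :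
    powerMeasure p (Set.Iio b) = ENNReal.ofReal (b ^ p / p) := by
  have hset : Set.Iio b ∩ Set.Ioi 0 = Set.Ioo 0 b := by
    ext x; simp [and_comm]
  rw [powerMeasure, withDensity_apply _ measurableSet_Iio,
    Measure.restrict_restrict measurableSet_Iio, hset,
    ← ofReal_integral_eq_lintegral_ofReal, ← integral_Ioc_eq_integral_Ioo,
    ← intervalIntegral.integral_of_le hb, integral_rpow (Or.inl (by linarith))]
  · simp [Real.zero_rpow hp.ne']
  · have h := intervalIntegral.intervalIntegrable_rpow' (a := 0) (b := b) (r := p - 1) (by linarith)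
    exact ((intervalIntegrable_iff_integrableOn_Ioc_of_le hb).1 h).mono_set
      Set.Ioo_subset_Ioc_self
  · filter_upwards [ae_restrict_mem measurableSet_Ioo] with x hx
    exact Real.rpow_nonneg hx.1.le _

lemma measure_eq_of_Iio {μ ν : Measure ℝ} (hfin : ∀ b, μ (Set.Iio b) ≠ ∞)
    (h : ∀ b, μ (Set.Iio b) = ν (Set.Iio b)) : μ = ν := by
  have : IsLocallyFiniteMeasure μ :=
    ⟨fun x => ⟨Set.Iio (x + 1), Iio_mem_nhds (by linarith), (hfin _).lt_top⟩⟩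
  refine Measure.ext_of_Ico μ ν fun a b hab => ?_
  have hsub : Set.Iio a ⊆ Set.Iio b := Set.Iio_subset_Iio hab.le
  have hd : Set.Ico a b = Set.Iio b \ Set.Iio a := by ext x; simp
  rw [hd, measure_sdiff hsub measurableSet_Iio.nullMeasurableSet (hfin a),
    measure_sdiff hsub measurableSet_Iio.nullMeasurableSet (h a ▸ hfin a), h, h]

/-- Under a Haar measure, a nonnegative function homogeneous of degree two is distributed as a
power law on the half-line, since its sublevel sets are dilates of one another. -/
lemma exists_map_eq_smul_powerMeasure {E : Type*} [NormedAddCommGroup E] [NormedSpace ℝ E]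
    [MeasurableSpace E] [BorelSpace E] [FiniteDimensional ℝ E] [Nontrivial E] (μ : Measure E)
    [μ.IsAddHaarMeasure] {q : E → ℝ} (hq : Measurable q) (hq0 : ∀ x, 0 ≤ q x)
    (hsmul : ∀ (t : ℝ) x, q (t • x) = t ^ 2 * q x) (hfin : μ {x | q x < 1} ≠ ∞) :
    ∃ C : ℝ≥0∞, μ.map q = C • powerMeasure ((Module.finrank ℝ E : ℝ) / 2) := by
  have hd : 0 < (Module.finrank ℝ E : ℝ) / 2 := by
    have : 0 < Module.finrank ℝ E := Module.finrank_pos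
    positivity
  set p := (Module.finrank ℝ E : ℝ) / 2 with hp
  have hneg : ∀ b ≤ (0 : ℝ), q ⁻¹' Set.Iio b = ∅ := fun b hb => by
    ext x
    simp only [Set.mem_preimage, Set.mem_Iio, Set.mem_empty_iff_false, iff_false, not_lt]
    exact hb.trans (hq0 x)
  have hpos : ∀ b : ℝ, 0 < b →
      μ (q ⁻¹' Set.Iio b) = ENNReal.ofReal (b ^ p) * μ {x | q x < 1} := fun b hb => by
    have hs : 0 < Real.sqrt b := Real.sqrt_pos.2 hb
    have hset : q ⁻¹' Set.Iio b = Real.sqrt b • {x | q x < 1} := by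
      ext x
      rw [Set.mem_smul_set_iff_inv_smul_mem₀ hs.ne']
      simp only [Set.mem_preimage, Set.mem_Iio, Set.mem_ofPred_eq, hsmul, inv_pow,
        Real.sq_sqrt hb.le]
      rw [inv_mul_lt_iff₀ hb, mul_one]
    rw [hset, Measure.addHaar_smul, abs_of_nonneg (by positivity), Real.sqrt_eq_rpow,
      ← Real.rpow_natCast, ← Real.rpow_mul hb.le, hp]
    congr 3
    ring
  refine ⟨μ {x | q x < 1} * ENNReal.ofReal p, measure_eq_of_Iio (fun b => ?_) fun b => ?_⟩
  · rw [Measure.map_apply hq measurableSet_Iio]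
    rcases le_or_gt b 0 with hb | hb
    · simp [hneg b hb]
    · rw [hpos b hb]
      exact ENNReal.mul_ne_top ENNReal.ofReal_ne_top hfin
  · rw [Measure.map_apply hq measurableSet_Iio, Measure.smul_apply, smul_eq_mul]
    rcases le_or_gt b 0 with hb | hb
    · simp [hneg b hb, powerMeasure_Iio_of_nonpos p hb]
    · rw [hpos b hb, powerMeasure_Iio hd hb.le, mul_assoc, ← ENNReal.ofReal_mul hd.le,
        mul_div_cancel₀ _ hd.ne', mul_comm]

end PowerLaw

/-! ### Measures with densities -/

section WithDensity

open scoped ENNReal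

lemma map_withDensity_comp {α β : Type*} [MeasurableSpace α] [MeasurableSpace β] (μ : Measure α)
    {q : α → β} (hq : Measurable q) {g : β → ℝ≥0∞} (hg : Measurable g) :
    (μ.withDensity fun x => g (q x)).map q = (μ.map q).withDensity g := by
  ext s hs
  rw [Measure.map_apply hq hs, withDensity_apply _ (hq hs), withDensity_apply _ hs,
    setLIntegral_map hs hg hq]

lemma lintegral_pi_succ {α : Type*} [MeasurableSpace α] {n : ℕ} (μ : Fin (n + 1) → Measure α)
    [∀ i, SigmaFinite (μ i)] {f : (Fin (n + 1) → α) → ℝ≥0∞} (hf : Measurable f) :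
    ∫⁻ x, f x ∂Measure.pi μ =
      ∫⁻ a, ∫⁻ y, f (Fin.cons a y) ∂Measure.pi (fun i => μ i.succ) ∂μ 0 := by
  have hm : Measurable fun p : α × (Fin n → α) =>
      f ((MeasurableEquiv.piFinSuccAbove (fun _ : Fin (n + 1) => α) 0).symm p) :=
    hf.comp (MeasurableEquiv.measurable _)
  rw [← (measurePreserving_piFinSuccAbove μ 0).symm.lintegral_comp hf,
    lintegral_prod _ hm.aemeasurable]
  simp [MeasurableEquiv.piFinSuccAbove, Fin.insertNthEquiv]

lemma measurePreserving_withDensity {α : Type*} [MeasurableSpace α] {μ : Measure α} {T : α → α}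
    (hT : MeasurePreserving T μ μ) {h : α → ℝ≥0∞} (hh : Measurable h) (hinv : ∀ x, h (T x) = h x) :
    MeasurePreserving T (μ.withDensity h) (μ.withDensity h) := by
  refine ⟨hT.measurable, ?_⟩
  have := map_withDensity_comp μ hT.measurable hh
  simpa only [hinv, hT.map_eq] using this

end WithDensity

/-! ### Radial laws and their marginals -/

section Radial

open scoped ENNReal

variable (K : Type*) [NormedDivisionRing K] [MeasureSpace K]

/-- The measure on row vectors with density `g (|x|²)`. -/
noncomputable def rowLaw (n : ℕ) (g : ℝ → ℝ≥0∞) : Measure (Fin n → K) :=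
  volume.withDensity fun x => g (sqLength x)

/-- The law of the squared length `|x|²` when `x` has density `g (|x|²)`. -/
noncomputable def radialLaw (n : ℕ) (g : ℝ → ℝ≥0∞) : Measure ℝ :=
  (rowLaw K n g).map sqLength

/-- If `x` has density `g (|x|²)`, then the vector of all coordinates of `x` but one has density
`marginal K g (|y|²)`. -/
noncomputable def marginal (g : ℝ → ℝ≥0∞) (r : ℝ) : ℝ≥0∞ := ∫⁻ z : K, g (‖z‖ ^ 2 + r)

variable {K} [BorelSpace K] {g : ℝ → ℝ≥0∞}

lemma measurable_marginal [SFinite (volume : Measure K)] (hg : Measurable g) :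
    Measurable (marginal K g) := by
  unfold marginal
  refine Measurable.lintegral_prod_right' (f := fun p : ℝ × K => g (‖p.2‖ ^ 2 + p.1)) ?_
  fun_prop

lemma measurable_marginal_iterate [SFinite (volume : Measure K)] (hg : Measurable g) (i : ℕ) :
    Measurable ((marginal K)^[i] g) := by
  induction i with
  | zero => exact hg
  | succ i ih => rw [Function.iterate_succ_apply']; exact measurable_marginal ih

variable [SigmaFinite (volume : Measure K)]

/-- Deleting a coordinate pushes radial laws to radial laws. -/
lemma measurePreserving_tail {n : ℕ} (hg : Measurable g) :
    MeasurePreserving (fun (x : Fin (n + 1) → K) (j : Fin n) => x j.succ)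
      (rowLaw K (n + 1) g) (rowLaw K n (marginal K g)) := by
  have hm : Measurable (fun (x : Fin (n + 1) → K) (j : Fin n) => x j.succ) := by fun_prop
  refine ⟨hm, ?_⟩
  have hmp := (volume_preserving_piFinSuccAbove (fun _ : Fin (n + 1) => K) 0).symm
  ext s hs
  have hF : Measurable (fun x : Fin (n + 1) → K => g (sqLength x)) :=
    hg.comp measurable_sqLength
  rw [Measure.map_apply hm hs, rowLaw, rowLaw, withDensity_apply _ (hm hs),
    withDensity_apply _ hs, ← lintegral_indicator (hm hs), ← lintegral_indicator hs,
    ← hmp.lintegral_comp (hF.indicator (hm hs)), Measure.volume_eq_prod, lintegral_prod_symm']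
  · refine lintegral_congr fun y => ?_
    have key : ∀ x : K, (MeasurableEquiv.piFinSuccAbove (fun _ : Fin (n + 1) => K) 0).symm (x, y) =
        Fin.cons x y := fun x => by
      simp [MeasurableEquiv.piFinSuccAbove, Fin.insertNthEquiv]
    by_cases hy : y ∈ s
    · simp only [key, Set.indicator_of_mem hy]
      unfold marginal
      refine lintegral_congr fun x => ?_
      rw [Set.indicator_of_mem (by simpa using hy), sqLength_succ]
      simp
    · simp only [key, Set.indicator_of_notMem hy]
      rw [← lintegral_zero]
      refine lintegral_congr fun x => ?_
      rw [Set.indicator_of_notMem (by simpa using hy)]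
  · exact (hF.indicator (hm hs)).comp (MeasurableEquiv.measurable _)

/-- Deleting `i` coordinates of a random vector leaves a random vector. -/
lemma isProbabilityMeasure_rowLaw_marginal_iterate (hg : Measurable g) (n i : ℕ)
    (h : IsProbabilityMeasure (rowLaw K (n + i) g)) :
    IsProbabilityMeasure (rowLaw K n ((marginal K)^[i] g)) := by
  induction i generalizing n with
  | zero => exact h
  | succ i ih =>
    have h1 := ih (n + 1) (by rw [Nat.add_right_comm]; exact h)
    have ht := measurePreserving_tail (K := K) (n := n)
      (measurable_marginal_iterate (K := K) hg i)
    rw [Function.iterate_succ_apply', ← ht.map_eq]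
    exact Measure.isProbabilityMeasure_map ht.measurable.aemeasurable

omit [SigmaFinite (volume : Measure K)] in
lemma isProbabilityMeasure_radialLaw {n : ℕ} (h : IsProbabilityMeasure (rowLaw K n g)) :
    IsProbabilityMeasure (radialLaw K n g) :=
  Measure.isProbabilityMeasure_map measurable_sqLength.aemeasurable

end Radial

/-! ### Moduli of determinants -/

section Determinant

open scoped ENNReal

variable {K : Type*} [NormedDivisionRing K] [MeasurableSpace K]

/-- A modulus of the determinant for square matrices over a possibly noncommutative field: a
measurable multiplicative function, computed by expansion along the first row when that row is a
multiple of the first basis vector. -/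
structure IsDetModulus (D : (n : ℕ) → Matrix (Fin n) (Fin n) K → ℝ) : Prop where
  measurable : ∀ n, Measurable fun X : Fin n → Fin n → K => D n (Matrix.of X)
  one : ∀ n, D n 1 = 1
  mul : ∀ (n : ℕ) (X Y : Matrix (Fin n) (Fin n) K), D n (X * Y) = D n X * D n Y
  succ : ∀ (n : ℕ) (X : Matrix (Fin (n + 1)) (Fin (n + 1)) K), (∀ j : Fin n, X 0 j.succ = 0) →
    D (n + 1) X = ‖X 0 0‖ * D n (X.submatrix Fin.succ Fin.succ)

variable {D : (n : ℕ) → Matrix (Fin n) (Fin n) K → ℝ}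

/-- An involution has modulus one. -/
lemma IsDetModulus.sq_mul_involution (hD : IsDetModulus D) {n : ℕ} (X : Matrix (Fin n) (Fin n) K)
    {U : Matrix (Fin n) (Fin n) K} (hU : U * U = 1) : D n (X * U) ^ 2 = D n X ^ 2 := by
  have : D n U * D n U = 1 := by rw [← hD.mul, hU, hD.one]
  rw [hD.mul, mul_pow, sq (D n U), this, mul_one]

end Determinant

/-! ### The law of the determinant for radial rows -/

section Law

open scoped ENNReal

variable {K : Type*} [NormedDivisionRing K] [MeasureSpace K] [BorelSpace K]
  [StarRing K] [NormedAlgebra ℝ K] [IsStarNorm K] [FiniteDimensional ℝ K]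
  [SecondCountableTopology K] [(volume : Measure K).IsAddHaarMeasure]
  {D : (n : ℕ) → Matrix (Fin n) (Fin n) K → ℝ}

lemma measurePreserving_vecMul_rowLaw {n : ℕ} (v : Fin n → K) {g : ℝ → ℝ≥0∞} (hg : Measurable g) :
    MeasurePreserving (fun y => Matrix.vecMul y (householder v)) (rowLaw K n g) (rowLaw K n g) :=
  measurePreserving_withDensity (measurePreserving_vecMul_householder v)
    (hg.comp measurable_sqLength) fun y => by
      simp only [sqLength_vecMul_householder]

/-- Given the first row `x`, rotate it to a multiple of the first basis vector.  This does not
change the law of the other rows, so that the determinant becomes `|x|` times the determinant of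
the remaining rows with their first coordinates deleted. -/
lemma lintegral_detModulus_cons (hD : IsDetModulus D) {n : ℕ} {g : Fin n → ℝ → ℝ≥0∞}
    (hg : ∀ i, Measurable (g i)) (hp : ∀ i, IsProbabilityMeasure (rowLaw K (n + 1) (g i)))
    (x : Fin (n + 1) → K) {f : ℝ → ℝ≥0∞} (hf : Measurable f) :
    ∫⁻ Y, f (D (n + 1) (Matrix.of (Fin.cons x Y)) ^ 2)
        ∂Measure.pi (fun i => rowLaw K (n + 1) (g i)) =
      ∫⁻ Z, f (sqLength x * D n (Matrix.of Z) ^ 2)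
        ∂Measure.pi (fun i => rowLaw K n (marginal K (g i))) := by
  obtain ⟨v, hv⟩ := exists_householder_vecMul_succ_eq_zero x
  have hp' : ∀ i, IsProbabilityMeasure (rowLaw K n (marginal K (g i))) := fun i =>
    isProbabilityMeasure_rowLaw_marginal_iterate (hg i) n 1 (hp i)
  have hs : ∀ i, SigmaFinite (rowLaw K (n + 1) (g i)) := fun i => have := hp i; inferInstance
  have hs' : ∀ i, SigmaFinite (rowLaw K n (marginal K (g i))) := fun i =>
    have := hp' i; inferInstance
  have hrot : MeasurePreserving
      (fun (Y : Fin n → Fin (n + 1) → K) i => Matrix.vecMul (Y i) (householder v))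
      (Measure.pi fun i => rowLaw K (n + 1) (g i)) (Measure.pi fun i => rowLaw K (n + 1) (g i)) :=
    measurePreserving_pi _ _ fun i => measurePreserving_vecMul_rowLaw v (hg i)
  have htail : MeasurePreserving (fun (Y : Fin n → Fin (n + 1) → K) i (j : Fin n) => Y i j.succ)
      (Measure.pi fun i => rowLaw K (n + 1) (g i))
      (Measure.pi fun i => rowLaw K n (marginal K (g i))) :=
    measurePreserving_pi _ _ fun i => measurePreserving_tail (hg i)
  have hmeas : Measurable fun Z : Fin n → Fin n → K =>
      f (sqLength x * D n (Matrix.of Z) ^ 2) :=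
    hf.comp (((hD.measurable n).pow_const 2).const_mul _)
  -- Both sides become integrals over `Y`: on the right, rotate, then delete the first column.
  rw [← (htail.comp hrot).lintegral_comp hmeas]
  refine lintegral_congr fun Y => ?_
  congr 1
  rw [← hD.sq_mul_involution _ (householder_mul_self v), hD.succ, mul_pow]
  · congr 1
    · have h := sqLength_vecMul_householder v x
      rw [sqLength_succ] at h
      simp only [hv] at h
      have h0 : sqLength (fun _ : Fin n => (0 : K)) = 0 := sqLength_eq_zero.2 rfl
      rw [← h, h0, add_zero]
      rfl
  · exact hv

/-- For independent rows with radial densities, `|det|²` is distributed as a product of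
independent variables: the `i`-th one is the squared length of the last `n - i` coordinates of the
`i`-th row. -/
theorem map_detModulus_sq (hD : IsDetModulus D) {n : ℕ} {g : Fin n → ℝ → ℝ≥0∞}
    (hg : ∀ i, Measurable (g i)) (hp : ∀ i, IsProbabilityMeasure (rowLaw K n (g i))) :
    (Measure.pi fun i => rowLaw K n (g i)).map (fun X => D n (Matrix.of X) ^ 2) =
      (Measure.pi fun i : Fin n =>
        radialLaw K (n - i) ((marginal K)^[i] (g i))).map fun y => ∏ i, y i := by
  induction n with
  | zero =>
    have h1 : ∀ X : Fin 0 → Fin 0 → K, D 0 (Matrix.of X) = 1 := fun X => by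
      rw [← hD.one 0]; congr 1; exact Subsingleton.elim _ _
    simp only [h1, Finset.univ_eq_empty, Finset.prod_empty, Measure.map_const, measure_univ,
      one_pow]
    rw [Measure.pi_of_empty]
    simp
  | succ n ih =>
    have hp' : ∀ i : Fin (n + 1),
        IsProbabilityMeasure (radialLaw K (n + 1 - i) ((marginal K)^[i] (g i))) := fun i => by
      refine isProbabilityMeasure_radialLaw
        (isProbabilityMeasure_rowLaw_marginal_iterate (hg i) _ _ ?_)
      rw [Nat.sub_add_cancel i.is_lt.le]
      exact hp i
    have hs : ∀ i, SigmaFinite (rowLaw K (n + 1) (g i)) := fun i => have := hp i; inferInstance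
    have hs' : ∀ i : Fin (n + 1),
        SigmaFinite (radialLaw K (n + 1 - i) ((marginal K)^[i] (g i))) := fun i =>
      have := hp' i; inferInstance
    refine Measure.ext_of_lintegral _ fun f hf => ?_
    have hDm : Measurable fun X : Fin (n + 1) → Fin (n + 1) → K => D (n + 1) (Matrix.of X) ^ 2 :=
      (hD.measurable (n + 1)).pow_const 2
    have hDm' : Measurable fun X : Fin n → Fin n → K => D n (Matrix.of X) ^ 2 :=
      (hD.measurable n).pow_const 2
    have hprod : ∀ m : ℕ, Measurable fun y : Fin m → ℝ => ∏ i, y i := fun m => by fun_prop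
    have hfD : Measurable fun X : Fin (n + 1) → Fin (n + 1) → K =>
        f (D (n + 1) (Matrix.of X) ^ 2) := hf.comp hDm
    have hfprod : Measurable fun y : Fin (n + 1) → ℝ => f (∏ i, y i) := hf.comp (hprod _)
    have hmul : ∀ r : ℝ, Measurable fun t : ℝ => f (r * t) := fun r => hf.comp (by fun_prop)
    rw [lintegral_map hf hDm, lintegral_map hf (hprod _), lintegral_pi_succ _ hfD,
      lintegral_pi_succ _ hfprod]
    have hinner : ∀ x : Fin (n + 1) → K,
        ∫⁻ Y, f (D (n + 1) (Matrix.of (Fin.cons x Y)) ^ 2)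
            ∂Measure.pi (fun i : Fin n => rowLaw K (n + 1) (g i.succ)) =
          ∫⁻ y, f (sqLength x * ∏ i, y i) ∂Measure.pi fun i : Fin n =>
            radialLaw K (n + 1 - i.succ) ((marginal K)^[i.succ] (g i.succ)) := fun x => by
      have hq : ∀ i : Fin n, IsProbabilityMeasure (rowLaw K n (marginal K (g i.succ))) := fun i =>
        isProbabilityMeasure_rowLaw_marginal_iterate (hg i.succ) n 1 (hp i.succ)
      rw [lintegral_detModulus_cons hD (fun i => hg i.succ) (fun i => hp i.succ) x hf,
        ← lintegral_map (hmul (sqLength x)) hDm',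
        ih (fun i => measurable_marginal (hg i.succ)) hq,
        lintegral_map (hmul (sqLength x)) (hprod n)]
      simp only [Fin.val_succ, Nat.add_sub_add_right, Function.iterate_succ_apply]
    have houter : Measurable fun r : ℝ => ∫⁻ y, f (r * ∏ i, y i) ∂Measure.pi fun i : Fin n =>
        radialLaw K (n + 1 - i.succ) ((marginal K)^[i.succ] (g i.succ)) := by
      refine Measurable.lintegral_prod_right' (f := fun p : ℝ × (Fin n → ℝ) =>
        f (p.1 * ∏ i, p.2 i)) (hf.comp ?_)
      fun_prop
    simp only [hinner, Fin.prod_univ_succ, Fin.cons_zero, Fin.cons_succ]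
    rw [← lintegral_map houter measurable_sqLength]
    rfl

end Law

/-! ### Scaling of power laws -/

section PowerLaw

open scoped ENNReal

/-- The power law is homogeneous under dilations. -/
lemma powerMeasure_eq_smul_map {a t : ℝ} (ha : 0 < a) (ht : 0 < t) :
    powerMeasure a = ENNReal.ofReal (t ^ a) • (powerMeasure a).map fun u => t * u := by
  have hm : Measurable fun u : ℝ => t * u := by fun_prop
  have hfin : ∀ b : ℝ, powerMeasure a (Set.Iio b) ≠ ∞ := fun b => by
    rcases le_total b 0 with hb | hb
    · simp [powerMeasure_Iio_of_nonpos a hb]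
    · simp [powerMeasure_Iio ha hb]
  refine measure_eq_of_Iio hfin fun b => ?_
  have hset : (fun u : ℝ => t * u) ⁻¹' Set.Iio b = Set.Iio (b / t) := by
    ext u
    simp [lt_div_iff₀' ht]
  rw [Measure.smul_apply, Measure.map_apply hm measurableSet_Iio, hset, smul_eq_mul]
  rcases le_total b 0 with hb | hb
  · rw [powerMeasure_Iio_of_nonpos a hb,
      powerMeasure_Iio_of_nonpos a (div_nonpos_of_nonpos_of_nonneg hb ht.le), mul_zero]
  · rw [powerMeasure_Iio ha hb, powerMeasure_Iio ha (by positivity),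
      ← ENNReal.ofReal_mul (by positivity), Real.div_rpow hb ht.le]
    congr 1
    field_simp

lemma lintegral_powerMeasure_scale {a t : ℝ} (ha : 0 < a) (ht : 0 < t) {f : ℝ → ℝ≥0∞}
    (hf : Measurable f) :
    ∫⁻ s, f s ∂powerMeasure a = ENNReal.ofReal (t ^ a) * ∫⁻ u, f (t * u) ∂powerMeasure a := by
  conv_lhs => rw [powerMeasure_eq_smul_map ha ht]
  rw [lintegral_smul_measure, lintegral_map hf (by fun_prop), smul_eq_mul]

lemma ae_powerMeasure_pos (a : ℝ) : ∀ᵐ r ∂powerMeasure a, 0 < r :=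
  (withDensity_absolutelyContinuous _ _).ae_le (ae_restrict_mem measurableSet_Ioi)

lemma smul_powerMeasure_withDensity (c : ℝ≥0∞) (a : ℝ) {h : ℝ → ℝ≥0∞} (hh : Measurable h) :
    c • (powerMeasure a).withDensity h =
      volume.withDensity ((Set.Ioi 0).indicator fun r =>
        c * (ENNReal.ofReal (r ^ (a - 1)) * h r)) := by
  have hm : Measurable fun r : ℝ => ENNReal.ofReal (r ^ (a - 1)) := by fun_prop
  rw [withDensity_indicator measurableSet_Ioi, powerMeasure, ← withDensity_mul _ hm hh,
    ← withDensity_smul _ (hm.mul hh)]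
  rfl

end PowerLaw

/-! ### Squared lengths up to normalization -/

section RadialPower

open scoped ENNReal

variable (K : Type*) [NormedDivisionRing K] [MeasureSpace K] [BorelSpace K]
  [NormedAlgebra ℝ K] [FiniteDimensional ℝ K]
  [SecondCountableTopology K] [(volume : Measure K).IsAddHaarMeasure]

/-- One constant, depending on `K` and `n` only, serves all radial profiles. -/
lemma exists_radialLaw_eq {n : ℕ} (hn : 0 < n) : ∃ C : ℝ≥0∞, ∀ g : ℝ → ℝ≥0∞, Measurable g →
    radialLaw K n g = C • (powerMeasure (Module.finrank ℝ K * n / 2)).withDensity g := by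
  have : Nonempty (Fin n) := ⟨⟨0, hn⟩⟩
  obtain ⟨C, hC⟩ := exists_map_eq_smul_powerMeasure (volume : Measure (Fin n → K))
    (q := sqLength) measurable_sqLength sqLength_nonneg
    (fun t x => by
      simp only [sqLength, Pi.smul_apply, norm_smul, mul_pow, Real.norm_eq_abs, sq_abs,
        Finset.mul_sum])
    (by
      refine ((measure_mono fun x hx => ?_).trans_lt
        (measure_ball_lt_top (x := (0 : Fin n → K)) (r := 1))).ne
      rw [mem_ball_zero_iff, pi_norm_lt_iff one_pos]
      intro j
      have h1 : ‖x j‖ ^ 2 ≤ sqLength x :=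
        Finset.single_le_sum (f := fun j => ‖x j‖ ^ 2) (fun _ _ => sq_nonneg _) (Finset.mem_univ j)
      exact lt_of_pow_lt_pow_left₀ 2 zero_le_one (by simpa using h1.trans_lt hx))
  refine ⟨C, fun g hg => ?_⟩
  have hdim : (Module.finrank ℝ (Fin n → K) : ℝ) = Module.finrank ℝ K * n := by
    rw [Module.finrank_pi_fintype]
    simp [mul_comm]
  rw [radialLaw, rowLaw, map_withDensity_comp _ measurable_sqLength hg, hC, hdim,
    withDensity_smul_measure]

omit [SecondCountableTopology K] in
lemma exists_marginal_eq : ∃ C : ℝ≥0∞, ∀ g : ℝ → ℝ≥0∞, Measurable g → ∀ r : ℝ,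
    marginal K g r = C * ∫⁻ s, g (s + r) ∂powerMeasure ((Module.finrank ℝ K : ℝ) / 2) := by
  obtain ⟨C, hC⟩ := exists_map_eq_smul_powerMeasure (volume : Measure K)
    (q := fun z => ‖z‖ ^ 2) (by fun_prop) (fun _ => sq_nonneg _)
    (fun t x => by simp only [norm_smul, mul_pow, Real.norm_eq_abs, sq_abs])
    (by
      refine ((measure_mono fun x hx => ?_).trans_lt
        (measure_ball_lt_top (x := (0 : K)) (r := 1))).ne
      rw [mem_ball_zero_iff]
      exact lt_of_pow_lt_pow_left₀ 2 zero_le_one (by simpa using hx))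
  refine ⟨C, fun g hg r => ?_⟩
  have hg' : Measurable fun s : ℝ => g (s + r) := hg.comp (by fun_prop)
  rw [marginal, ← lintegral_map (f := fun s : ℝ => g (s + r)) hg' (by fun_prop), hC,
    lintegral_smul_measure, smul_eq_mul]

variable {K}

/-- A one-parameter family of radial profiles is stable under marginals if its members reproduce
one another, up to constants, when integrated against a power law; then so do the iterated
marginals. -/
lemma exists_marginal_iterate_eq {h : ℝ → ℝ → ℝ≥0∞} (hh : ∀ p, Measurable (h p))
    (hstep : ∀ p, ∃ c : ℝ≥0∞, ∀ r, 0 ≤ r →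
      ∫⁻ s, h p (s + r) ∂powerMeasure ((Module.finrank ℝ K : ℝ) / 2) =
        c * h (p + (Module.finrank ℝ K : ℝ) / 2) r)
    (c₀ : ℝ≥0∞) (p : ℝ) (i : ℕ) :
    ∃ c : ℝ≥0∞, ∀ r, 0 ≤ r → (marginal K)^[i] (fun r => c₀ * h p r) r =
      c * h (p + Module.finrank ℝ K * i / 2) r := by
  induction i with
  | zero => exact ⟨c₀, fun r _ => by simp⟩
  | succ i ih =>
    obtain ⟨c, hc⟩ := ih
    obtain ⟨C, hC⟩ := exists_marginal_eq K
    obtain ⟨c', hc'⟩ := hstep (p + Module.finrank ℝ K * i / 2)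
    refine ⟨C * (c * c'), fun r hr => ?_⟩
    have hm : Measurable fun s : ℝ => h (p + Module.finrank ℝ K * i / 2) (s + r) :=
      (hh _).comp (by fun_prop)
    rw [Function.iterate_succ_apply', hC _ (measurable_marginal_iterate ((hh p).const_mul c₀) i)]
    have hae : ∫⁻ s, (marginal K)^[i] (fun r => c₀ * h p r) (s + r)
          ∂powerMeasure ((Module.finrank ℝ K : ℝ) / 2) =
        ∫⁻ s, c * h (p + Module.finrank ℝ K * i / 2) (s + r)
          ∂powerMeasure ((Module.finrank ℝ K : ℝ) / 2) := by
      refine lintegral_congr_ae ?_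
      filter_upwards [ae_powerMeasure_pos _] with s hs
      exact hc _ (by linarith)
    rw [hae, lintegral_const_mul _ hm, hc' r hr]
    have hpar : p + Module.finrank ℝ K * i / 2 + (Module.finrank ℝ K : ℝ) / 2 =
        p + Module.finrank ℝ K * ((i + 1 : ℕ) : ℝ) / 2 := by
      push_cast; ring
    rw [hpar]
    simp only [mul_assoc]

/-- Two probability measures that are multiples of the same measure coincide. -/
lemma smul_measure_eq_of_isProbabilityMeasure {α : Type*} [MeasurableSpace α] {μ : Measure α}
    {c c' : ℝ≥0∞} (h : IsProbabilityMeasure (c • μ)) (h' : IsProbabilityMeasure (c' • μ)) :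
    c • μ = c' • μ := by
  have h1 : c * μ Set.univ = 1 := h.measure_univ
  have h2 : c' * μ Set.univ = 1 := h'.measure_univ
  rw [ENNReal.eq_inv_of_mul_eq_one_left h1, ENNReal.eq_inv_of_mul_eq_one_left h2]

/-- The law of the squared length is determined by the radial profile up to a constant: no
normalization has to be computed. -/
lemma radialLaw_eq_of_proportional {n : ℕ} (hn : 0 < n) {g h : ℝ → ℝ≥0∞} (hg : Measurable g)
    (hh : Measurable h) (hp : IsProbabilityMeasure (radialLaw K n g))
    (hgh : ∃ c : ℝ≥0∞, ∀ r, 0 ≤ r → g r = c * h r) {T : Measure ℝ} (hT : IsProbabilityMeasure T)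
    (hTh : ∃ c : ℝ≥0∞, T = c • (powerMeasure (Module.finrank ℝ K * n / 2)).withDensity h) :
    radialLaw K n g = T := by
  obtain ⟨C, hC⟩ := exists_radialLaw_eq K hn
  obtain ⟨c, hc⟩ := hgh
  obtain ⟨c', rfl⟩ := hTh
  have hgc : (powerMeasure (Module.finrank ℝ K * n / 2)).withDensity g =
      c • (powerMeasure (Module.finrank ℝ K * n / 2)).withDensity h := by
    rw [← withDensity_smul _ hh]
    refine withDensity_congr_ae ?_
    filter_upwards [ae_powerMeasure_pos _] with r hr
    exact hc r hr.le
  rw [hC g hg, hgc, smul_smul] at hp ⊢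
  exact smul_measure_eq_of_isProbabilityMeasure hp hT

end RadialPower

/-! ### The three families of densities -/

section Families

open scoped ENNReal

/-- The factor `exp (-b r)` splits off. -/
lemma exists_lintegral_exp_shift (a b : ℝ) : ∃ c : ℝ≥0∞, ∀ r : ℝ, 0 ≤ r →
    ∫⁻ s, ENNReal.ofReal (Real.exp (-(b * (s + r)))) ∂powerMeasure a =
      c * ENNReal.ofReal (Real.exp (-(b * r))) := by
  refine ⟨∫⁻ s, ENNReal.ofReal (Real.exp (-(b * s))) ∂powerMeasure a, fun r _ => ?_⟩
  rw [← lintegral_mul_const _ (by fun_prop)]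
  refine lintegral_congr fun s => ?_
  rw [← ENNReal.ofReal_mul (Real.exp_nonneg _), ← Real.exp_add]
  congr 2
  ring

/-- Substitute `s = (1 + r) u`. -/
lemma exists_lintegral_one_add_shift {a : ℝ} (ha : 0 < a) (p : ℝ) : ∃ c : ℝ≥0∞, ∀ r : ℝ, 0 ≤ r →
    ∫⁻ s, ENNReal.ofReal ((1 + (s + r)) ^ p) ∂powerMeasure a =
      c * ENNReal.ofReal ((1 + r) ^ (p + a)) := by
  refine ⟨∫⁻ s, ENNReal.ofReal ((1 + s) ^ p) ∂powerMeasure a, fun r hr => ?_⟩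
  have h1 : 0 < 1 + r := by linarith
  rw [lintegral_powerMeasure_scale ha h1 (by fun_prop), Real.rpow_add h1, mul_comm (_ ^ p),
    ENNReal.ofReal_mul (by positivity), mul_left_comm]
  congr 1
  rw [mul_comm, ← lintegral_const_mul _ (by fun_prop)]
  refine lintegral_congr_ae ?_
  filter_upwards [ae_powerMeasure_pos _] with s hs
  rw [← ENNReal.ofReal_mul (by positivity), ← Real.mul_rpow h1.le (by linarith)]
  congr 2
  ring

/-- The profile `(1 - r) ^ (p - 1)`, cut off at `r = 1`. -/
noncomputable def betaProfile (p r : ℝ) : ℝ≥0∞ :=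
  (Set.Iio 1).indicator (fun r => ENNReal.ofReal ((1 - r) ^ (p - 1))) r

lemma measurable_betaProfile (p : ℝ) : Measurable (betaProfile p) :=
  Measurable.indicator (by fun_prop) measurableSet_Iio

/-- Substitute `s = (1 - r) u` if `r < 1`; otherwise both sides vanish. -/
lemma exists_lintegral_betaProfile_shift {a : ℝ} (ha : 0 < a) (p : ℝ) :
    ∃ c : ℝ≥0∞, ∀ r : ℝ, 0 ≤ r →
      ∫⁻ s, betaProfile p (s + r) ∂powerMeasure a = c * betaProfile (p + a) r := by
  refine ⟨∫⁻ s, betaProfile p s ∂powerMeasure a, fun r hr => ?_⟩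
  rcases lt_or_ge r 1 with h | h
  · have h1 : 0 < 1 - r := by linarith
    have hexp : p + a - 1 = p - 1 + a := by ring
    have hm : Measurable fun s : ℝ => betaProfile p (s + r) :=
      (measurable_betaProfile p).comp (by fun_prop)
    rw [lintegral_powerMeasure_scale ha h1 hm]
    conv_rhs => rw [betaProfile, Set.indicator_of_mem (by simpa using h), hexp, Real.rpow_add h1,
      mul_comm (_ ^ (p - 1)), ENNReal.ofReal_mul (by positivity), mul_left_comm]
    congr 1
    rw [mul_comm, ← lintegral_const_mul _ (measurable_betaProfile p)]
    refine lintegral_congr fun s => ?_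
    rcases lt_or_ge s 1 with hs | hs
    · have h2 : (1 - r) * s + r < 1 := by nlinarith
      rw [betaProfile, betaProfile, Set.indicator_of_mem (by simpa using h2),
        Set.indicator_of_mem (by simpa using hs), ← ENNReal.ofReal_mul (by positivity),
        ← Real.mul_rpow h1.le (by linarith)]
      congr 2
      ring
    · have h2 : 1 ≤ (1 - r) * s + r := by nlinarith
      rw [betaProfile, betaProfile, Set.indicator_of_notMem (by simpa using h2),
        Set.indicator_of_notMem (by simpa using hs), mul_zero]
  · have h0 : betaProfile (p + a) r = 0 := Set.indicator_of_notMem (by simpa using h) _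
    rw [h0, mul_zero, ← lintegral_zero]
    refine lintegral_congr_ae ?_
    filter_upwards [ae_powerMeasure_pos _] with s hs
    exact Set.indicator_of_notMem (by simp only [Set.mem_Iio, not_lt]; linarith) _

lemma exists_gammaMeasure_eq {a r : ℝ} (ha : 0 < a) (hr : 0 < r) : ∃ c : ℝ≥0∞, gammaMeasure a r =
    c • (powerMeasure a).withDensity fun y => ENNReal.ofReal (Real.exp (-(r * y))) := by
  refine ⟨ENNReal.ofReal (r ^ a / Real.Gamma a), ?_⟩
  rw [smul_powerMeasure_withDensity _ _ (by fun_prop), gammaMeasure]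
  refine withDensity_congr_ae ?_
  filter_upwards [Measure.ae_ne volume (0 : ℝ)] with y hy
  rcases lt_or_gt_of_ne hy with h | h
  · rw [gammaPDF_of_neg h, Set.indicator_of_notMem (by simpa using h.le)]
  · have hG := Real.Gamma_pos_of_pos ha
    rw [gammaPDF_of_nonneg h.le, Set.indicator_of_mem (by simpa using h),
      ← ENNReal.ofReal_mul (by positivity), ← ENNReal.ofReal_mul (by positivity), mul_assoc]

lemma exists_betaMeasure_eq {a b : ℝ} (ha : 0 < a) (hb : 0 < b) : ∃ c : ℝ≥0∞, betaMeasure a b =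
    c • (powerMeasure a).withDensity (betaProfile b) := by
  refine ⟨ENNReal.ofReal (1 / ProbabilityTheory.beta a b), ?_⟩
  have hB := beta_pos ha hb
  rw [smul_powerMeasure_withDensity _ _ (measurable_betaProfile b), betaMeasure]
  congr 1
  ext y
  rcases le_or_gt y 0 with h | h
  · rw [betaPDF_eq_zero_of_nonpos h, Set.indicator_of_notMem (by simpa using h)]
  rw [Set.indicator_of_mem (by simpa using h)]
  rcases lt_or_ge y 1 with h1 | h1
  · rw [betaPDF_of_pos_lt_one h h1, betaProfile, Set.indicator_of_mem (by simpa using h1),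
      ← ENNReal.ofReal_mul (by positivity), ← ENNReal.ofReal_mul (by positivity), mul_assoc]
  · rw [betaPDF_eq_zero_of_one_le h1, betaProfile, Set.indicator_of_notMem (by simpa using h1)]
    simp

lemma exists_betaPrimeMeasure_eq {a b : ℝ} (ha : 0 < a) (hb : 0 < b) :
    ∃ c : ℝ≥0∞, betaPrimeMeasure a b =
      c • (powerMeasure a).withDensity fun y => ENNReal.ofReal ((1 + y) ^ (-(a + b))) := by
  refine ⟨ENNReal.ofReal (1 / ProbabilityTheory.beta a b), ?_⟩
  have hB := beta_pos ha hb
  rw [smul_powerMeasure_withDensity _ _ (by fun_prop), betaPrimeMeasure]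
  congr 1
  ext y
  rcases le_or_gt y 0 with h | h
  · rw [if_neg h.not_gt, Set.indicator_of_notMem (by simpa using h), ENNReal.ofReal_zero]
  · rw [if_pos h, Set.indicator_of_mem (by simpa using h),
      ← ENNReal.ofReal_mul (by positivity), ← ENNReal.ofReal_mul (by positivity), mul_assoc]

/-- If `t` has law `Beta[a, b]`, then `t / (1 - t)` has law `BetaP[a, b]`. -/
lemma map_betaMeasure_div_one_sub {a b : ℝ} (ha : 0 < a) (hb : 0 < b) :
    (betaMeasure a b).map (fun t => t / (1 - t)) = betaPrimeMeasure a b := by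
  have hB := beta_pos ha hb
  have hm : Measurable fun t : ℝ => t / (1 - t) := by fun_prop
  have himg : (fun t : ℝ => t / (1 - t)) '' Set.Ioo 0 1 = Set.Ioi 0 := by
    ext y
    simp only [Set.mem_image, Set.mem_Ioo, Set.mem_Ioi]
    constructor
    · rintro ⟨t, ⟨h0, h1⟩, rfl⟩
      exact div_pos h0 (by linarith)
    · intro hy
      have h1 : 0 < 1 + y := by linarith
      refine ⟨y / (1 + y), ⟨by positivity, by rw [div_lt_one h1]; linarith⟩, ?_⟩
      field_simp
      simp
  have hinj : Set.InjOn (fun t : ℝ => t / (1 - t)) (Set.Ioo 0 1) := by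
    intro s hs t ht hst
    have h1 : 1 - s ≠ 0 := by linarith [hs.2]
    have h2 : 1 - t ≠ 0 := by linarith [ht.2]
    simp only at hst
    rw [div_eq_div_iff h1 h2] at hst
    linarith
  have hder : ∀ t ∈ Set.Ioo (0 : ℝ) 1,
      HasDerivWithinAt (fun t : ℝ => t / (1 - t)) (1 / (1 - t) ^ 2) (Set.Ioo 0 1) t := by
    intro t ht
    have h1 : 1 - t ≠ 0 := by linarith [ht.2]
    have := (hasDerivAt_id t).div ((hasDerivAt_id t).const_sub 1) h1
    refine (this.congr_deriv ?_).hasDerivWithinAt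
    simp
  -- Change variables on `(0, 1)`, which carries all the mass, and compare the densities.
  ext s hs
  rw [Measure.map_apply hm hs, betaMeasure, betaPrimeMeasure, withDensity_apply _ (hm hs),
    withDensity_apply _ hs, ← lintegral_indicator (hm hs), ← lintegral_indicator hs]
  have hL : ∀ t ∉ Set.Ioo (0 : ℝ) 1,
      ((fun t : ℝ => t / (1 - t)) ⁻¹' s).indicator (betaPDF a b) t = 0 := fun t ht => by
    have : betaPDF a b t = 0 := by
      rw [betaPDF_eq, if_neg (by simpa using ht), ENNReal.ofReal_zero]
    by_cases h : t ∈ (fun t : ℝ => t / (1 - t)) ⁻¹' s <;> simp [Set.indicator, this]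
  have hR : ∀ y ∉ Set.Ioi (0 : ℝ), s.indicator (fun y => ENNReal.ofReal
      (if 0 < y then (1 / ProbabilityTheory.beta a b) * y ^ (a - 1) * (1 + y) ^ (-(a + b))
        else 0)) y = 0 := fun y hy => by
    have : ¬ 0 < y := hy
    simp [Set.indicator, this]
  rw [← setLIntegral_eq_of_support_subset (Function.support_subset_iff'.2 hL),
    ← setLIntegral_eq_of_support_subset (Function.support_subset_iff'.2 hR), ← himg,
    lintegral_image_eq_lintegral_abs_deriv_mul measurableSet_Ioo hder hinj]
  refine setLIntegral_congr_fun measurableSet_Ioo fun t ht => ?_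
  have h1 : 0 < 1 - t := by linarith [ht.2]
  have h0 : 0 < t := ht.1
  by_cases h : t / (1 - t) ∈ s
  · rw [Set.indicator_of_mem (by simpa using h), Set.indicator_of_mem h, if_pos (div_pos h0 h1),
      betaPDF_of_pos_lt_one h0 ht.2, ← ENNReal.ofReal_mul (abs_nonneg _),
      abs_of_nonneg (by positivity)]
    congr 1
    have h2 : 1 + t / (1 - t) = (1 - t)⁻¹ := by field_simp; ring
    rw [h2, Real.div_rpow h0.le h1.le, Real.inv_rpow h1.le, Real.rpow_neg h1.le, inv_inv]
    have h3 : (1 - t) ^ (a + b) = (1 - t) ^ (a - 1) * (1 - t) ^ (b - 1) * (1 - t) ^ 2 := by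
      rw [← Real.rpow_natCast, ← Real.rpow_add h1, ← Real.rpow_add h1]
      congr 1
      push_cast
      ring
    rw [h3]
    have h4 := (Real.rpow_pos_of_pos h1 (a - 1)).ne'
    field_simp
  · rw [Set.indicator_of_notMem (by simpa using h), Set.indicator_of_notMem h, mul_zero]

lemma isProbabilityMeasure_betaPrimeMeasure {a b : ℝ} (ha : 0 < a) (hb : 0 < b) :
    IsProbabilityMeasure (betaPrimeMeasure a b) := by
  have := isProbabilityMeasureBeta ha hb
  rw [← map_betaMeasure_div_one_sub ha hb]
  exact Measure.isProbabilityMeasure_map (by fun_prop)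

end Families

/-! ### Quaternion matrices as complex matrices -/

section Quaternion

lemma quaternionBlock_mul (p q : ℍ[ℝ]) :
    quaternionBlock (p * q) = quaternionBlock p * quaternionBlock q := by
  ext i j
  fin_cases i <;> fin_cases j <;> apply Complex.ext <;>
    simp [quaternionBlock, Matrix.mul_apply, Fin.sum_univ_two] <;> ring

lemma quaternionBlock_add (p q : ℍ[ℝ]) :
    quaternionBlock (p + q) = quaternionBlock p + quaternionBlock q := by
  ext i j
  fin_cases i <;> fin_cases j <;> apply Complex.ext <;>
    simp [quaternionBlock] <;> ring

lemma quaternionBlock_zero : quaternionBlock 0 = 0 := by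
  ext i j
  fin_cases i <;> fin_cases j <;> apply Complex.ext <;> simp [quaternionBlock]

lemma quaternionBlock_one : quaternionBlock 1 = 1 := by
  ext i j
  fin_cases i <;> fin_cases j <;> apply Complex.ext <;> simp [quaternionBlock]

lemma det_quaternionBlock (q : ℍ[ℝ]) : (quaternionBlock q).det = ((‖q‖ ^ 2 : ℝ) : ℂ) := by
  rw [sq, ← Quaternion.normSq_eq_norm_mul_self, Quaternion.normSq_def']
  apply Complex.ext <;> simp [quaternionBlock, Matrix.det_fin_two, sq] <;> ring

/-- Matrices multiply blockwise, and `quaternionBlock` is a ring homomorphism. -/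
lemma quaternionToComplexMatrix_mul {n : ℕ} (X Y : Matrix (Fin n) (Fin n) ℍ[ℝ]) :
    quaternionToComplexMatrix (X * Y) =
      quaternionToComplexMatrix X * quaternionToComplexMatrix Y := by
  let f : ℍ[ℝ] →+ Matrix (Fin 2) (Fin 2) ℂ :=
    { toFun := quaternionBlock, map_zero' := quaternionBlock_zero, map_add' := quaternionBlock_add }
  ext ⟨i, a⟩ ⟨j, b⟩
  have h : quaternionBlock ((X * Y) i j) =
      ∑ k, quaternionBlock (X i k) * quaternionBlock (Y k j) := by
    simp only [← quaternionBlock_mul]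
    exact map_sum f _ _
  have h' := congrFun (congrFun h a) b
  rw [Matrix.sum_apply] at h'
  simpa only [quaternionToComplexMatrix, Matrix.of_apply, Matrix.mul_apply (M := Matrix.of _),
    Fintype.sum_prod_type, Matrix.mul_apply (M := quaternionBlock _)] using h'

lemma quaternionToComplexMatrix_one {n : ℕ} :
    quaternionToComplexMatrix (1 : Matrix (Fin n) (Fin n) ℍ[ℝ]) = 1 := by
  ext ⟨i, a⟩ ⟨j, b⟩
  by_cases h : i = j
  · subst h
    simp [quaternionToComplexMatrix, quaternionBlock_one, Matrix.one_apply]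
  · simp [quaternionToComplexMatrix, quaternionBlock_zero, Matrix.one_apply, h]

lemma det_quaternionToComplexMatrix_succ {n : ℕ} (X : Matrix (Fin (n + 1)) (Fin (n + 1)) ℍ[ℝ])
    (h : ∀ j : Fin n, X 0 j.succ = 0) :
    (quaternionToComplexMatrix X).det = (quaternionBlock (X 0 0)).det *
      (quaternionToComplexMatrix (X.submatrix Fin.succ Fin.succ)).det := by
  -- the index set `Fin (n + 1) × Fin 2`, split into the first block and the remaining ones
  let e : Fin 2 ⊕ (Fin n × Fin 2) ≃ Fin (n + 1) × Fin 2 :=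
    { toFun := Sum.elim (fun a => (0, a)) fun p => (p.1.succ, p.2)
      invFun := fun p => Fin.cases (motive := fun _ => Fin 2 ⊕ (Fin n × Fin 2))
        (Sum.inl p.2) (fun i => Sum.inr (i, p.2)) p.1
      left_inv := by rintro (a | ⟨i, a⟩) <;> rfl
      right_inv := by
        rintro ⟨i, a⟩
        refine Fin.cases rfl (fun _ => rfl) i }
  have hblock : (quaternionToComplexMatrix X).submatrix e e =
      Matrix.fromBlocks (quaternionBlock (X 0 0)) 0
        (Matrix.of fun (p : Fin n × Fin 2) b => quaternionBlock (X p.1.succ 0) p.2 b)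
        (quaternionToComplexMatrix (X.submatrix Fin.succ Fin.succ)) := by
    ext (a | ⟨i, a⟩) (b | ⟨j, b⟩)
    · rfl
    · simp [e, quaternionToComplexMatrix, h, quaternionBlock_zero]
    · rfl
    · rfl
  rw [← Matrix.det_submatrix_equiv_self e, hblock, Matrix.det_fromBlocks_zero₁₂]

lemma measurable_quaternionBlock (a b : Fin 2) :
    Measurable fun q : ℍ[ℝ] => quaternionBlock q a b := by
  have h1 : Measurable fun q : ℍ[ℝ] => (⟨q.re, q.imI⟩ : ℂ) :=
    Complex.measurableEquivRealProd.symm.measurable.comp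
      (Quaternion.continuous_re.measurable.prodMk Quaternion.continuous_imI.measurable)
  have h2 : Measurable fun q : ℍ[ℝ] => (⟨q.imJ, q.imK⟩ : ℂ) :=
    Complex.measurableEquivRealProd.symm.measurable.comp
      (Quaternion.continuous_imJ.measurable.prodMk Quaternion.continuous_imK.measurable)
  fin_cases a <;> fin_cases b
  · exact h1
  · exact h2
  · exact (Complex.continuous_conj.measurable.comp h2).neg
  · exact Complex.continuous_conj.measurable.comp h1

end Quaternion

/-! ### The three number systems -/

section Instances

instance : IsStarNorm ℝ where
  mul_star_self z := by simp [sq]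

instance : IsStarNorm ℂ where
  mul_star_self z := by
    rw [RCLike.star_def, Complex.mul_conj, Complex.normSq_eq_norm_sq]
    rfl

instance : IsStarNorm ℍ[ℝ] where
  star_smul r z := by simp
  mul_star_self z := by
    rw [Quaternion.self_mul_star, Quaternion.normSq_eq_norm_mul_self, ← sq]
    rfl

lemma measurable_det {ι R α : Type*} [Fintype ι] [DecidableEq ι] [CommRing R] [MeasurableSpace R]
    [MeasurableAdd₂ R] [MeasurableMul₂ R] [MeasurableNeg R] [MeasurableSpace α]
    {M : α → Matrix ι ι R}
    (hM : ∀ i j, Measurable fun a => M a i j) : Measurable fun a => (M a).det := by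
  simp only [Matrix.det_apply]
  refine Finset.measurable_fun_sum _ fun σ _ => ?_
  have h : Measurable fun a => ∏ i, M a (σ i) i := Finset.measurable_fun_prod _ fun i _ => hM _ _
  rcases Int.units_eq_one_or (Equiv.Perm.sign σ) with hs | hs <;> simpa [hs] using h

/-- The case of a commutative field, which covers `ℝ` and `ℂ`. -/
lemma isDetModulus_norm_det {K : Type*} [NormedField K] [MeasurableSpace K] [BorelSpace K]
    [SecondCountableTopology K] :
    IsDetModulus fun (n : ℕ) (X : Matrix (Fin n) (Fin n) K) => ‖X.det‖ where
  measurable n := (measurable_det fun i j => by simp only [Matrix.of_apply]; fun_prop).norm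
  one n := by simp
  mul n X Y := by simp
  succ n X h := by
    rw [Matrix.det_succ_row_zero, Fin.sum_univ_succ]
    simp [h, Matrix.submatrix]

lemma isDetModulus_quaternion :
    IsDetModulus fun (n : ℕ) (X : Matrix (Fin n) (Fin n) ℍ[ℝ]) =>
      Real.sqrt ‖(quaternionToComplexMatrix X).det‖ where
  measurable n := by
    refine (measurable_det fun p q => ?_).norm.sqrt
    exact (measurable_quaternionBlock p.2 q.2).comp
      ((measurable_pi_apply q.1).comp (measurable_pi_apply p.1))
  one n := by simp [quaternionToComplexMatrix_one]
  mul n X Y := by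
    rw [quaternionToComplexMatrix_mul, Matrix.det_mul, norm_mul, Real.sqrt_mul (norm_nonneg _)]
  succ n X h := by
    rw [det_quaternionToComplexMatrix_succ X h, norm_mul, Real.sqrt_mul (norm_nonneg _),
      det_quaternionBlock, Complex.norm_real, Real.norm_eq_abs, abs_of_nonneg (by positivity),
      Real.sqrt_sq (norm_nonneg _)]

end Instances

/-! ### Moments -/

section Moments

open scoped ENNReal

lemma gammaMeasure_moment {a r : ℝ} (ha : 0 < a) (hr : 0 < r) {α : ℂ} (hα : -a < α.re) :
    Integrable (fun y : ℝ => (y : ℂ) ^ α) (gammaMeasure a r) ∧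
      ∫ y, (y : ℂ) ^ α ∂gammaMeasure a r = (1 / (r : ℂ)) ^ α * complexPoch a α := by
  have hz : 0 < ((a : ℂ) + α).re := by simp; linarith
  have hint := Complex.integral_cpow_mul_exp_neg_mul_Ioi hz hr
  have hr0 : (1 / (r : ℂ)) ≠ 0 := by simp [hr.ne']
  have hG : 0 < Real.Gamma a := Real.Gamma_pos_of_pos ha
  -- The Mellin integral is nonzero, so its integrand is integrable.
  have hcon : Integrable (fun t : ℝ => (t : ℂ) ^ ((a : ℂ) + α - 1) * Complex.exp (-(r * t)))
      (volume.restrict (Set.Ioi 0)) := by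
    refine .of_integral_ne_zero ?_
    rw [hint]
    exact mul_ne_zero (Complex.cpow_ne_zero_iff.2 (Or.inl hr0)) (Complex.Gamma_ne_zero_of_re_pos hz)
  have hae : (fun y : ℝ => (gammaPDF a r y).toReal • (y : ℂ) ^ α) =ᵐ[volume]
      (Set.Ioi 0).indicator fun t : ℝ => ((r ^ a / Real.Gamma a : ℝ) : ℂ) *
        ((t : ℂ) ^ ((a : ℂ) + α - 1) * Complex.exp (-(r * t))) := by
    filter_upwards [Measure.ae_ne volume (0 : ℝ)] with y hy
    rcases lt_or_gt_of_ne hy with h | h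
    · simp [gammaPDF_of_neg h, h.le]
    · rw [gammaPDF_of_nonneg h.le, ENNReal.toReal_ofReal (by positivity),
        Set.indicator_of_mem (by simpa using h), Complex.real_smul]
      have hy' : (y : ℂ) ≠ 0 := by exact_mod_cast h.ne'
      have hexp : (a : ℂ) + α - 1 = ((a - 1 : ℝ) : ℂ) + α := by push_cast; ring
      rw [hexp, Complex.cpow_add _ _ hy', ← Complex.ofReal_cpow h.le]
      push_cast
      ring
  have hlt : ∀ᵐ y ∂(volume : Measure ℝ), gammaPDF a r y < ∞ :=
    .of_forall fun y => ENNReal.ofReal_lt_top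
  have hmeas : Measurable (gammaPDF a r) := (measurable_gammaPDFReal a r).ennreal_ofReal
  constructor
  · rw [gammaMeasure, integrable_withDensity_iff_integrable_smul' hmeas hlt,
      integrable_congr hae, integrable_indicator_iff measurableSet_Ioi]
    exact hcon.const_mul _
  · rw [gammaMeasure, integral_withDensity_eq_integral_toReal_smul hmeas hlt,
      integral_congr_ae hae, integral_indicator measurableSet_Ioi, integral_const_mul, hint,
      Complex.cpow_add _ _ hr0, complexPoch]
    have h1 : ((r ^ a : ℝ) : ℂ) * (1 / (r : ℂ)) ^ (a : ℂ) = 1 := by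
      rw [← Complex.ofReal_one, ← Complex.ofReal_div, ← Complex.ofReal_cpow (by positivity),
        ← Complex.ofReal_mul, one_div, Real.inv_rpow hr.le, mul_inv_cancel₀ (by positivity)]
    rw [Complex.ofReal_div, ← Complex.Gamma_ofReal]
    linear_combination ((1 / (r : ℂ)) ^ α * Complex.Gamma (a + α) / Complex.Gamma a) * h1

/-- The mixed moments serve both the beta law and, through `t / (1 - t)`, the beta prime law. -/
lemma betaMeasure_moment {a b : ℝ} (ha : 0 < a) (hb : 0 < b) {α γ : ℂ} (hα : -a < α.re)
    (hγ : -b < γ.re) :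
    Integrable (fun y : ℝ => (y : ℂ) ^ α * (1 - (y : ℂ)) ^ γ) (betaMeasure a b) ∧
      ∫ y, (y : ℂ) ^ α * (1 - (y : ℂ)) ^ γ ∂betaMeasure a b =
        Complex.Gamma (a + α) * Complex.Gamma (b + γ) / Complex.Gamma (a + b + (α + γ)) /
          (Complex.Gamma a * Complex.Gamma b / Complex.Gamma (a + b)) := by
  have hz : 0 < ((a : ℂ) + α).re := by simp; linarith
  have hw : 0 < ((b : ℂ) + γ).re := by simp; linarith
  have hB := beta_pos ha hb
  have hcon := Complex.betaIntegral_convergent hz hw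
  rw [intervalIntegrable_iff_integrableOn_Ioo_of_le zero_le_one] at hcon
  have hint : ∫ t : ℝ in Set.Ioo 0 1,
      (t : ℂ) ^ ((a : ℂ) + α - 1) * (1 - (t : ℂ)) ^ ((b : ℂ) + γ - 1) =
        Complex.Gamma (a + α) * Complex.Gamma (b + γ) / Complex.Gamma (a + b + (α + γ)) := by
    rw [← integral_Ioc_eq_integral_Ioo, ← intervalIntegral.integral_of_le zero_le_one,
      ← Complex.betaIntegral, Complex.betaIntegral_eq_Gamma_mul_div _ _ hz hw]
    congr 2
    ring
  have heq : (fun y : ℝ => (betaPDF a b y).toReal • ((y : ℂ) ^ α * (1 - (y : ℂ)) ^ γ)) =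
      (Set.Ioo 0 1).indicator fun t : ℝ => ((1 / ProbabilityTheory.beta a b : ℝ) : ℂ) *
        ((t : ℂ) ^ ((a : ℂ) + α - 1) * (1 - (t : ℂ)) ^ ((b : ℂ) + γ - 1)) := by
    ext y
    by_cases hy : y ∈ Set.Ioo (0 : ℝ) 1
    · have h0 : 0 < y := hy.1
      have h1 : 0 < 1 - y := by linarith [hy.2]
      rw [betaPDF_of_pos_lt_one hy.1 hy.2, ENNReal.toReal_ofReal (by positivity),
        Set.indicator_of_mem hy, Complex.real_smul]
      have hy0 : (y : ℂ) ≠ 0 := by exact_mod_cast h0.ne'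
      have hy1 : 1 - (y : ℂ) ≠ 0 := by exact_mod_cast h1.ne'
      have e1 : (a : ℂ) + α - 1 = ((a - 1 : ℝ) : ℂ) + α := by push_cast; ring
      have e2 : (b : ℂ) + γ - 1 = ((b - 1 : ℝ) : ℂ) + γ := by push_cast; ring
      have e3 : (1 - (y : ℂ)) = ((1 - y : ℝ) : ℂ) := by push_cast; ring
      rw [e1, e2, Complex.cpow_add _ _ hy0, Complex.cpow_add _ _ hy1, e3,
        ← Complex.ofReal_cpow h0.le, ← Complex.ofReal_cpow h1.le]
      push_cast
      ring
    · have hy' : ¬ (0 < y ∧ y < 1) := hy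
      rw [Set.indicator_of_notMem hy, betaPDF_eq, if_neg hy']
      simp
  have hlt : ∀ᵐ y ∂(volume : Measure ℝ), betaPDF a b y < ∞ :=
    .of_forall fun y => ENNReal.ofReal_lt_top
  have hmeas : Measurable (betaPDF a b) := (measurable_betaPDFReal a b).ennreal_ofReal
  constructor
  · rw [betaMeasure, integrable_withDensity_iff_integrable_smul' hmeas hlt, heq,
      integrable_indicator_iff measurableSet_Ioo]
    exact hcon.const_mul _
  · rw [betaMeasure, integral_withDensity_eq_integral_toReal_smul hmeas hlt, heq,
      integral_indicator measurableSet_Ioo, integral_const_mul, hint, ProbabilityTheory.beta]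
    push_cast [← Complex.Gamma_ofReal]
    rw [one_div, mul_comm, ← div_eq_mul_inv]

lemma betaMeasure_moment_left {a b : ℝ} (ha : 0 < a) (hb : 0 < b) {α : ℂ} (hα : -a < α.re) :
    Integrable (fun y : ℝ => (y : ℂ) ^ α) (betaMeasure a b) ∧
      ∫ y, (y : ℂ) ^ α ∂betaMeasure a b = complexPoch a α / complexPoch (a + b) α := by
  have h := betaMeasure_moment ha hb hα (γ := 0) (by simpa using hb)
  simp only [Complex.cpow_zero, mul_one, add_zero] at h
  refine ⟨h.1, h.2.trans ?_⟩
  have h1 : Complex.Gamma b ≠ 0 := Complex.Gamma_ne_zero_of_re_pos (by simpa using hb)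
  have h2 : Complex.Gamma (a + b) ≠ 0 :=
    Complex.Gamma_ne_zero_of_re_pos (by simp; linarith)
  have h3 : Complex.Gamma a ≠ 0 := Complex.Gamma_ne_zero_of_re_pos (by simpa using ha)
  have h4 : Complex.Gamma (a + b + α) ≠ 0 :=
    Complex.Gamma_ne_zero_of_re_pos (by simp; linarith)
  rw [complexPoch, complexPoch]
  field_simp

lemma ae_pos_of_eq_smul_powerMeasure {T : Measure ℝ} {a : ℝ} {h : ℝ → ℝ≥0∞}
    (hT : ∃ c : ℝ≥0∞, T = c • (powerMeasure a).withDensity h) : ∀ᵐ y ∂T, 0 < y := by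
  obtain ⟨c, rfl⟩ := hT
  exact Measure.ae_smul_measure ((withDensity_absolutelyContinuous _ _).ae_le
    (ae_powerMeasure_pos a)) c

lemma ae_betaMeasure_lt_one (a b : ℝ) : ∀ᵐ y ∂betaMeasure a b, y < 1 := by
  have hmeas : Measurable (betaPDF a b) := (measurable_betaPDFReal a b).ennreal_ofReal
  rw [betaMeasure, ae_withDensity_iff hmeas]
  refine .of_forall fun y hy => ?_
  by_contra h
  exact hy (betaPDF_eq_zero_of_one_le (not_lt.1 h))

lemma measurable_ofReal_cpow (α : ℂ) : Measurable fun y : ℝ => (y : ℂ) ^ α :=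
  Complex.measurable_ofReal.pow_const α

lemma betaPrimeMeasure_moment {a b : ℝ} (ha : 0 < a) (hb : 0 < b) {α : ℂ} (hα : -a < α.re)
    (hα' : α.re < b) :
    Integrable (fun y : ℝ => (y : ℂ) ^ α) (betaPrimeMeasure a b) ∧
      ∫ y, (y : ℂ) ^ α ∂betaPrimeMeasure a b = complexPoch a α * complexPoch b (-α) := by
  have h := betaMeasure_moment ha hb hα (γ := -α) (by simpa using hα')
  have hm : Measurable fun t : ℝ => t / (1 - t) := by fun_prop
  have hae : (fun t : ℝ => ((t / (1 - t) : ℝ) : ℂ) ^ α) =ᵐ[betaMeasure a b]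
      fun y : ℝ => (y : ℂ) ^ α * (1 - (y : ℂ)) ^ (-α) := by
    filter_upwards [ae_pos_of_eq_smul_powerMeasure (exists_betaMeasure_eq ha hb),
      ae_betaMeasure_lt_one a b] with t h0 h1
    have h2 : 0 < 1 - t := by linarith
    have e3 : (1 - (t : ℂ)) = ((1 - t : ℝ) : ℂ) := by push_cast; ring
    rw [div_eq_mul_inv, Complex.ofReal_mul, Complex.mul_cpow_ofReal_nonneg h0.le (by positivity),
      e3, Complex.cpow_neg, Complex.ofReal_inv, Complex.inv_cpow]
    rw [Complex.arg_ofReal_of_nonneg h2.le]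
    exact Real.pi_pos.ne
  rw [← map_betaMeasure_div_one_sub ha hb]
  constructor
  · rw [integrable_map_measure (measurable_ofReal_cpow α).aestronglyMeasurable hm.aemeasurable]
    exact h.1.congr hae.symm
  · rw [integral_map hm.aemeasurable (measurable_ofReal_cpow α).aestronglyMeasurable,
      integral_congr_ae hae, h.2]
    have h2 : Complex.Gamma (a + b) ≠ 0 :=
      Complex.Gamma_ne_zero_of_re_pos (by simp; linarith)
    rw [complexPoch, complexPoch, add_neg_cancel, add_zero]
    field_simp

lemma ofReal_prod_cpow {ι : Type*} (s : Finset ι) {y : ι → ℝ} (hy : ∀ i, 0 ≤ y i) (α : ℂ) :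
    ((∏ i ∈ s, y i : ℝ) : ℂ) ^ α = ∏ i ∈ s, (y i : ℂ) ^ α := by
  classical
  induction s using Finset.induction_on with
  | empty => simp
  | insert i s hi ih =>
    rw [Finset.prod_insert hi, Finset.prod_insert hi, Complex.ofReal_mul,
      Complex.mul_cpow_ofReal_nonneg (hy i) (Finset.prod_nonneg fun j _ => hy j), ih]

/-- Moments of a product of independent positive variables. -/
lemma map_prod_moment {n : ℕ} {m : Fin n → Measure ℝ} (hm : ∀ i, IsProbabilityMeasure (m i))
    (hpos : ∀ i, ∀ᵐ y ∂m i, 0 < y) {α : ℂ} {M : Fin n → ℂ}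
    (hM : ∀ i, Integrable (fun y : ℝ => (y : ℂ) ^ α) (m i) ∧ ∫ y, (y : ℂ) ^ α ∂m i = M i) :
    Integrable (fun y : ℝ => (y : ℂ) ^ α) ((Measure.pi m).map fun y => ∏ i, y i) ∧
      ∫ y : ℝ, (y : ℂ) ^ α ∂((Measure.pi m).map fun y => ∏ i, y i) = ∏ i, M i := by
  have hp : Measurable fun y : Fin n → ℝ => ∏ i, y i := by fun_prop
  have hae : (fun y : Fin n → ℝ => ((∏ i, y i : ℝ) : ℂ) ^ α) =ᵐ[Measure.pi m]
      fun y => ∏ i, (y i : ℂ) ^ α := by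
    have h : ∀ᵐ y ∂Measure.pi m, ∀ i, 0 < y i := by
      rw [Filter.eventually_all]
      exact fun i => (Measure.quasiMeasurePreserving_eval m i).ae (hpos i)
    filter_upwards [h] with y hy
    exact ofReal_prod_cpow _ (fun i => (hy i).le) α
  constructor
  · rw [integrable_map_measure (measurable_ofReal_cpow α).aestronglyMeasurable hp.aemeasurable]
    exact (Integrable.fintype_prod (f := fun _ (y : ℝ) => (y : ℂ) ^ α)
      fun i => (hM i).1).congr hae.symm
  · rw [integral_map hp.aemeasurable (measurable_ofReal_cpow α).aestronglyMeasurable,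
      integral_congr_ae hae, integral_fintype_prod_eq_prod fun _ (y : ℝ) => (y : ℂ) ^ α]
    exact Finset.prod_congr rfl fun i _ => (hM i).2

/-- Moments of `d` read off from the law of `d ^ 2`. -/
lemma hasLaw_sq_moment {Ω : Type*} [MeasurableSpace Ω] {P : Measure Ω} {d : Ω → ℝ}
    (hd : ∀ ω, 0 ≤ d ω) {ν : Measure ℝ} (hlaw : HasLaw (fun ω => d ω ^ 2) ν P) {α M : ℂ}
    (hM : Integrable (fun y : ℝ => (y : ℂ) ^ α) ν ∧ ∫ y, (y : ℂ) ^ α ∂ν = M) :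
    Integrable (fun ω => (d ω : ℂ) ^ (2 * α)) P ∧ ∫ ω, (d ω : ℂ) ^ (2 * α) ∂P = M := by
  have h : (fun ω => (d ω : ℂ) ^ (2 * α)) = fun ω => ((d ω ^ 2 : ℝ) : ℂ) ^ α := by
    ext ω
    rw [show (2 : ℂ) * α = (2 : ℕ) * α by norm_num, Complex.cpow_nat_mul, sq, sq,
      Complex.ofReal_mul, Complex.mul_cpow_ofReal_nonneg (hd ω) (hd ω)]
  have hms : AEStronglyMeasurable (fun y : ℝ => (y : ℂ) ^ α) (P.map fun ω => d ω ^ 2) :=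
    (measurable_ofReal_cpow α).aestronglyMeasurable
  rw [h]
  rw [← hlaw.map_eq, integrable_map_measure hms hlaw.aemeasurable,
    integral_map hlaw.aemeasurable hms] at hM
  exact hM

end Moments

/-! ### Scaling of gamma laws -/

section GammaScale

open scoped ENNReal

lemma map_mul_gammaMeasure {a r s : ℝ} (ha : 0 < a) (hr : 0 < r) (hs : 0 < s) :
    (gammaMeasure a r).map (fun y => s * y) = gammaMeasure a (r / s) := by
  obtain ⟨c, hc⟩ := exists_gammaMeasure_eq ha hr
  obtain ⟨c', hc'⟩ := exists_gammaMeasure_eq ha (div_pos hr hs)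
  have hm : Measurable fun y : ℝ => s * y := by fun_prop
  have h1 := isProbabilityMeasure_gammaMeasure ha (div_pos hr hs)
  have h2 := isProbabilityMeasure_gammaMeasure ha hr
  have h3 : IsProbabilityMeasure ((gammaMeasure a r).map fun y => s * y) :=
    Measure.isProbabilityMeasure_map hm.aemeasurable
  have hfun : (fun y : ℝ => ENNReal.ofReal (Real.exp (-(r * y)))) =
      fun y => ENNReal.ofReal (Real.exp (-(r / s * (s * y)))) := by
    ext y
    congr 3
    field_simp
  have hleft : (gammaMeasure a r).map (fun y => s * y) =
      c • ((powerMeasure a).map fun y => s * y).withDensity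
        fun y => ENNReal.ofReal (Real.exp (-(r / s * y))) := by
    rw [hc, hfun, Measure.map_smul, map_withDensity_comp (powerMeasure a) hm
      (g := fun y => ENNReal.ofReal (Real.exp (-(r / s * y)))) (by fun_prop)]
  rw [powerMeasure_eq_smul_map ha hs, withDensity_smul_measure, smul_smul] at hc'
  rw [hleft] at h3 ⊢
  rw [hc'] at h1 ⊢
  exact smul_measure_eq_of_isProbabilityMeasure h3 h1

end GammaScale

/-! ### Gaussian, beta and beta prime rows -/

section Joint

open scoped ENNReal

variable {K : Type*} [NormedDivisionRing K] [MeasureSpace K] [BorelSpace K]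
  [StarRing K] [NormedAlgebra ℝ K] [IsStarNorm K] [FiniteDimensional ℝ K]
  [SecondCountableTopology K] [(volume : Measure K).IsAddHaarMeasure]
  {D : (n : ℕ) → Matrix (Fin n) (Fin n) K → ℝ}
  {Ω : Type*} [MeasurableSpace Ω] {P : Measure Ω} [IsProbabilityMeasure P]

/-- The law of `|det|²` for independent rows whose radial profiles `h i (p i)` belong to
one-parameter families stable under marginals. -/
lemma hasLaw_detModulus_sq (hD : IsDetModulus D) {n : ℕ} {X : Ω → Matrix (Fin n) (Fin n) K}
    (hX : iIndepFun (fun (i : Fin n) ω => (X ω i : Fin n → K)) P)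
    {h : Fin n → ℝ → ℝ → ℝ≥0∞} (hh : ∀ i p, Measurable (h i p))
    (hstep : ∀ i p, ∃ c : ℝ≥0∞, ∀ r, 0 ≤ r →
      ∫⁻ s, h i p (s + r) ∂powerMeasure ((Module.finrank ℝ K : ℝ) / 2) =
        c * h i (p + (Module.finrank ℝ K : ℝ) / 2) r)
    {c : Fin n → ℝ≥0∞} {p : Fin n → ℝ}
    (hlaw : ∀ i, HasLaw (fun ω => (X ω i : Fin n → K)) (rowLaw K n fun r => c i * h i (p i) r) P)
    {m : Fin n → Measure ℝ} (hm : ∀ i, IsProbabilityMeasure (m i))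
    (hmh : ∀ i : Fin n, ∃ c : ℝ≥0∞, m i =
      c • (powerMeasure (Module.finrank ℝ K * ((n : ℝ) - (i : ℕ)) / 2)).withDensity
        (h i (p i + Module.finrank ℝ K * (i : ℕ) / 2))) :
    HasLaw (fun ω => D n (X ω) ^ 2) ((Measure.pi m).map fun y => ∏ i, y i) P := by
  have hg : ∀ i, Measurable fun r => c i * h i (p i) r := fun i => (hh i _).const_mul _
  have hp : ∀ i, IsProbabilityMeasure (rowLaw K n fun r => c i * h i (p i) r) := fun i =>
    (hlaw i).isProbabilityMeasure_iff.1 inferInstance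
  have hrad : ∀ i : Fin n,
      radialLaw K (n - i) ((marginal K)^[i] fun r => c i * h i (p i) r) = m i := fun i => by
    have hpi : IsProbabilityMeasure
        (rowLaw K (n - i) ((marginal K)^[i] fun r => c i * h i (p i) r)) := by
      refine isProbabilityMeasure_rowLaw_marginal_iterate (hg i) _ _ ?_
      rw [Nat.sub_add_cancel i.is_lt.le]
      exact hp i
    refine radialLaw_eq_of_proportional (Nat.sub_pos_of_lt i.is_lt)
      (measurable_marginal_iterate (hg i) _) (hh i _) (isProbabilityMeasure_radialLaw hpi)
      (exists_marginal_iterate_eq (hh i) (hstep i) (c i) (p i) i) (hm i) ?_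
    rw [Nat.cast_sub i.is_lt.le]
    exact hmh i
  have hDm : Measurable fun X : Fin n → Fin n → K => D n (Matrix.of X) ^ 2 :=
    (hD.measurable n).pow_const 2
  have hXm : ∀ i, AEMeasurable (fun ω => (X ω i : Fin n → K)) P := fun i => (hlaw i).aemeasurable
  have hjoint : AEMeasurable (fun ω (i : Fin n) => (X ω i : Fin n → K)) P :=
    aemeasurable_pi_lambda _ hXm
  refine ⟨hDm.comp_aemeasurable hjoint, ?_⟩
  have h1 := AEMeasurable.map_map_of_aemeasurable (hDm.aemeasurable (μ := P.map
    fun ω (i : Fin n) => (X ω i : Fin n → K))) hjoint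
  rw [(iIndepFun_iff_map_fun_eq_pi_map hXm).1 hX] at h1
  simp only [fun i => (hlaw i).map_eq] at h1
  rw [map_detModulus_sq hD hg hp] at h1
  simp only [hrad] at h1
  exact h1.symm

/-- A product of scaled chi-squared variables, listed in reverse order of their degrees of freedom,
as a product of gamma variables. -/
lemma map_prod_chiSquared {n : ℕ} {b : ℝ} (hb : 0 < b) {σ : Fin n → ℝ} (hσ : ∀ i, 0 < σ i) :
    (Measure.pi fun i : Fin n => chiSquaredMeasure (b * (((i : ℕ) : ℝ) + 1))).map
        (fun y => ∏ i, σ i ^ 2 * y i) =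
      (Measure.pi fun i : Fin n =>
        gammaMeasure (b * ((n : ℝ) - (i : ℕ)) / 2) (1 / (2 * σ i ^ 2))).map fun y => ∏ i, y i := by
  have hpos : ∀ i : Fin n, 0 < b * ((n : ℝ) - (i : ℕ)) / 2 := fun i => by
    have : ((i : ℕ) : ℝ) < n := by exact_mod_cast i.is_lt
    have : 0 < (n : ℝ) - (i : ℕ) := by linarith
    positivity
  have hchi : ∀ i : Fin n, chiSquaredMeasure (b * (((Fin.revPerm i : Fin n) : ℕ) + 1 : ℝ)) =
      gammaMeasure (b * ((n : ℝ) - (i : ℕ)) / 2) (1 / 2) := fun i => by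
    rw [chiSquaredMeasure]
    congr 3
    rw [Fin.revPerm_apply, Fin.val_rev, Nat.cast_sub i.is_lt]
    push_cast
    ring
  have hs : ∀ i : Fin n, SigmaFinite (chiSquaredMeasure (b * (((i : ℕ) : ℝ) + 1))) := fun i => by
    have : IsProbabilityMeasure (chiSquaredMeasure (b * (((i : ℕ) : ℝ) + 1))) :=
      isProbabilityMeasure_gammaMeasure (by positivity) (by norm_num)
    infer_instance
  have hs' : ∀ i : Fin n, SigmaFinite
      (gammaMeasure (b * ((n : ℝ) - (i : ℕ)) / 2) (1 / (2 * σ i ^ 2))) := fun i => by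
    have := isProbabilityMeasure_gammaMeasure (hpos i)
      (r := 1 / (2 * σ i ^ 2)) (by have := hσ i; positivity)
    infer_instance
  have hrev := measurePreserving_piCongrLeft
    (fun i : Fin n => chiSquaredMeasure (b * (((i : ℕ) : ℝ) + 1))) Fin.revPerm
  simp only [hchi] at hrev
  have hscale : MeasurePreserving (fun (y : Fin n → ℝ) i => σ i ^ 2 * y i)
      (Measure.pi fun i : Fin n => gammaMeasure (b * ((n : ℝ) - (i : ℕ)) / 2) (1 / 2))
      (Measure.pi fun i : Fin n =>
        gammaMeasure (b * ((n : ℝ) - (i : ℕ)) / 2) (1 / (2 * σ i ^ 2))) := by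
    refine measurePreserving_pi _ _ fun i => ⟨by fun_prop, ?_⟩
    rw [map_mul_gammaMeasure (hpos i) (by norm_num) (pow_pos (hσ i) 2), div_div]
  rw [← hrev.map_eq, ← hscale.map_eq, Measure.map_map (by fun_prop) (MeasurableEquiv.measurable _),
    Measure.map_map (by fun_prop) hscale.measurable]
  congr 1
  ext y
  simp only [Function.comp_apply, Finset.prod_mul_distrib]
  congr 1
  rw [← Equiv.prod_comp Fin.revPerm]
  refine Finset.prod_congr rfl fun i _ => ?_
  rw [MeasurableEquiv.coe_piCongrLeft, Equiv.piCongrLeft_apply_apply]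

variable {N b : ℕ}

lemma half_dim_pos (hb : 0 < b) (i : Fin N) : 0 < (b : ℝ) * ((N : ℝ) - (i : ℕ)) / 2 := by
  have h1 : ((i : ℕ) : ℝ) < N := by exact_mod_cast i.is_lt
  have h2 : 0 < (N : ℝ) - (i : ℕ) := by linarith
  positivity

/-- The condition on the exponent is strongest for a single remaining coordinate. -/
lemma neg_half_dim_lt (i : Fin N) {t : ℝ} (ht : -((b : ℝ) / 2) < t) :
    -((b : ℝ) * ((N : ℝ) - (i : ℕ)) / 2) < t := by
  have h1 : ((i : ℕ) : ℝ) + 1 ≤ N := by exact_mod_cast i.is_lt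
  have h2 : (b : ℝ) * 1 ≤ b * ((N : ℝ) - (i : ℕ)) :=
    mul_le_mul_of_nonneg_left (by linarith) (Nat.cast_nonneg b)
  linarith

lemma gaussianRows_law_and_moments (hD : IsDetModulus D) (hD0 : ∀ X, 0 ≤ D N X)
    (hb : Module.finrank ℝ K = b) {X : Ω → Matrix (Fin N) (Fin N) K}
    (hX : iIndepFun (fun (i : Fin N) ω => (X ω i : Fin N → K)) P)
    (σ : Fin N → ℝ) (hσ : ∀ i, 0 < σ i)
    (hlaw : ∀ i, HasLaw (fun ω => (X ω i : Fin N → K)) (rowLaw K N fun r => ENNReal.ofReal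
      ((2 * Real.pi * σ i ^ 2) ^ (-(b * N / 2 : ℝ)) * Real.exp (-r / (2 * σ i ^ 2)))) P) :
    (∀ α : ℂ, -(b / 2 : ℝ) < α.re →
      Integrable (fun ω => (D N (X ω) : ℂ) ^ (2 * α)) P ∧
      ∫ ω, (D N (X ω) : ℂ) ^ (2 * α) ∂P =
        ∏ i : Fin N, ((2 * σ i ^ 2 : ℝ) : ℂ) ^ α *
          complexPoch ((b : ℂ) * ((N : ℂ) - (i : ℕ)) / 2) α) ∧
    HasLaw (fun ω => D N (X ω) ^ 2)
      ((Measure.pi fun i : Fin N => chiSquaredMeasure ((b : ℝ) * (((i : ℕ) : ℝ) + 1))).map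
        fun y => ∏ i, σ i ^ 2 * y i) P := by
  have hb0 : 0 < b := hb ▸ Module.finrank_pos
  have hr : ∀ i, 0 < 1 / (2 * σ i ^ 2) := fun i => by have := hσ i; positivity
  have hdens : ∀ i, (fun r : ℝ => ENNReal.ofReal
      ((2 * Real.pi * σ i ^ 2) ^ (-(b * N / 2 : ℝ)) * Real.exp (-r / (2 * σ i ^ 2)))) =
      fun r => ENNReal.ofReal ((2 * Real.pi * σ i ^ 2) ^ (-(b * N / 2 : ℝ))) *
        ENNReal.ofReal (Real.exp (-(1 / (2 * σ i ^ 2) * r))) := fun i => by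
    ext r
    rw [← ENNReal.ofReal_mul (by positivity)]
    congr 3
    ring
  simp only [hdens] at hlaw
  have hm : ∀ i : Fin N, IsProbabilityMeasure
      (gammaMeasure (b * ((N : ℝ) - (i : ℕ)) / 2) (1 / (2 * σ i ^ 2))) := fun i =>
    isProbabilityMeasure_gammaMeasure (half_dim_pos hb0 i) (hr i)
  have hmain := hasLaw_detModulus_sq hD hX
    (h := fun i _ r => ENNReal.ofReal (Real.exp (-(1 / (2 * σ i ^ 2) * r))))
    -- The Gaussian profile does not change under marginals, so its parameter is a dummy.
    (fun i _ => by fun_prop) (fun i _ => exists_lintegral_exp_shift _ _) (p := 0) hlaw hm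
    (fun i => by rw [hb]; exact exists_gammaMeasure_eq (half_dim_pos hb0 i) (hr i))
  refine ⟨fun α hα => hasLaw_sq_moment (fun ω => hD0 _) hmain (map_prod_moment hm
    (fun i => ae_pos_of_eq_smul_powerMeasure (exists_gammaMeasure_eq (half_dim_pos hb0 i) (hr i)))
    fun i => ?_), ?_⟩
  · have h := gammaMeasure_moment (half_dim_pos hb0 i) (hr i) (neg_half_dim_lt i hα)
    refine ⟨h.1, h.2.trans ?_⟩
    push_cast
    rw [one_div_one_div]
  · rw [map_prod_chiSquared (by exact_mod_cast hb0) hσ]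
    exact hmain

lemma betaOneRows_law_and_moments (hD : IsDetModulus D) (hD0 : ∀ X, 0 ≤ D N X)
    (hb : Module.finrank ℝ K = b) {X : Ω → Matrix (Fin N) (Fin N) K}
    (hX : iIndepFun (fun (i : Fin N) ω => (X ω i : Fin N → K)) P)
    (ν : Fin N → ℝ) (hν : ∀ i, 0 < ν i)
    (hlaw : ∀ i, HasLaw (fun ω => (X ω i : Fin N → K)) (rowLaw K N fun r => ENNReal.ofReal
      (open Classical in if r < 1 then
        Real.pi ^ (-(b * N / 2 : ℝ)) * realPoch (b * ν i / 2) (b * N / 2) *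
          (1 - r) ^ (b * ν i / 2 - 1 : ℝ) else 0)) P) :
    (∀ α : ℂ, -(b / 2 : ℝ) < α.re →
      Integrable (fun ω => (D N (X ω) : ℂ) ^ (2 * α)) P ∧
      ∫ ω, (D N (X ω) : ℂ) ^ (2 * α) ∂P =
        ∏ i : Fin N, complexPoch ((b : ℂ) * ((N : ℂ) - (i : ℕ)) / 2) α /
          complexPoch ((b : ℂ) * ((N : ℂ) + (ν i : ℂ)) / 2) α) ∧
    HasLaw (fun ω => D N (X ω) ^ 2)
      ((Measure.pi fun i : Fin N => betaMeasure ((b : ℝ) * ((N : ℝ) - (i : ℕ)) / 2)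
        ((b : ℝ) * (ν i + (i : ℕ)) / 2)).map fun y => ∏ i, y i) P := by
  have hb0 : 0 < b := hb ▸ Module.finrank_pos
  have hpos : ∀ i, 0 < (b : ℝ) * (ν i + (i : ℕ)) / 2 := fun i => by have := hν i; positivity
  have hdens : ∀ i, (fun r : ℝ => ENNReal.ofReal
      (open Classical in if r < 1 then
        Real.pi ^ (-(b * N / 2 : ℝ)) * realPoch (b * ν i / 2) (b * N / 2) *
          (1 - r) ^ (b * ν i / 2 - 1 : ℝ) else 0)) =
      fun r => ENNReal.ofReal
        (Real.pi ^ (-(b * N / 2 : ℝ)) * realPoch (b * ν i / 2) (b * N / 2)) *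
          betaProfile (b * ν i / 2) r := fun i => by
    ext r
    by_cases h : r < 1
    · have h0 := hν i
      have h1 : 0 ≤ realPoch (b * ν i / 2) (b * N / 2) :=
        div_nonneg (Real.Gamma_nonneg_of_nonneg (by positivity))
          (Real.Gamma_nonneg_of_nonneg (by positivity))
      rw [if_pos h, betaProfile, Set.indicator_of_mem (by simpa using h),
        ENNReal.ofReal_mul (by positivity)]
    · rw [if_neg h, betaProfile, Set.indicator_of_notMem (by simpa using h)]
      simp
  simp only [hdens] at hlaw
  have hm : ∀ i : Fin N, IsProbabilityMeasure
      (betaMeasure ((b : ℝ) * ((N : ℝ) - (i : ℕ)) / 2) ((b : ℝ) * (ν i + (i : ℕ)) / 2)) := fun i =>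
    isProbabilityMeasureBeta (half_dim_pos hb0 i) (hpos i)
  have hfin : 0 < (Module.finrank ℝ K : ℝ) / 2 := by rw [hb]; positivity
  have hmain := hasLaw_detModulus_sq hD hX (h := fun _ => betaProfile)
    (fun _ => measurable_betaProfile) (fun _ => exists_lintegral_betaProfile_shift hfin) hlaw hm
    (fun i => by
      rw [hb, show (b : ℝ) * ν i / 2 + b * (i : ℕ) / 2 = b * (ν i + (i : ℕ)) / 2 by ring]
      exact exists_betaMeasure_eq (half_dim_pos hb0 i) (hpos i))
  refine ⟨fun α hα => hasLaw_sq_moment (fun ω => hD0 _) hmain (map_prod_moment hm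
    (fun i => ae_pos_of_eq_smul_powerMeasure (exists_betaMeasure_eq (half_dim_pos hb0 i) (hpos i)))
    fun i => ?_), hmain⟩
  have h := betaMeasure_moment_left (half_dim_pos hb0 i) (hpos i) (neg_half_dim_lt i hα)
  refine ⟨h.1, h.2.trans ?_⟩
  push_cast
  congr 2
  ring

lemma betaTwoRows_law_and_moments (hD : IsDetModulus D) (hD0 : ∀ X, 0 ≤ D N X)
    (hb : Module.finrank ℝ K = b) {X : Ω → Matrix (Fin N) (Fin N) K}
    (hX : iIndepFun (fun (i : Fin N) ω => (X ω i : Fin N → K)) P)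
    (ω : Fin N → ℝ) (hω : ∀ i, 0 < ω i)
    (hlaw : ∀ i, HasLaw (fun x => (X x i : Fin N → K)) (rowLaw K N fun r => ENNReal.ofReal
      (Real.pi ^ (-(b * N / 2 : ℝ)) * realPoch (b * ω i / 2) (b * N / 2) *
        (1 + r) ^ (-(b * (N + ω i) / 2 : ℝ)))) P) :
    (∀ α : ℂ, -(b / 2 : ℝ) < α.re → (∀ i, α.re < (b : ℝ) * ω i / 2) →
      Integrable (fun x => (D N (X x) : ℂ) ^ (2 * α)) P ∧
      ∫ x, (D N (X x) : ℂ) ^ (2 * α) ∂P =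
        ∏ i : Fin N, complexPoch ((b : ℂ) * ((N : ℂ) - (i : ℕ)) / 2) α *
          complexPoch ((b : ℂ) * (ω i : ℂ) / 2) (-α)) ∧
    HasLaw (fun x => D N (X x) ^ 2)
      ((Measure.pi fun i : Fin N => betaPrimeMeasure ((b : ℝ) * ((N : ℝ) - (i : ℕ)) / 2)
        ((b : ℝ) * ω i / 2)).map fun y => ∏ i, y i) P := by
  have hb0 : 0 < b := hb ▸ Module.finrank_pos
  have hpos : ∀ i, 0 < (b : ℝ) * ω i / 2 := fun i => by have := hω i; positivity
  have hdens : ∀ i, (fun r : ℝ => ENNReal.ofReal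
      (Real.pi ^ (-(b * N / 2 : ℝ)) * realPoch (b * ω i / 2) (b * N / 2) *
        (1 + r) ^ (-(b * (N + ω i) / 2 : ℝ)))) =
      fun r => ENNReal.ofReal
        (Real.pi ^ (-(b * N / 2 : ℝ)) * realPoch (b * ω i / 2) (b * N / 2)) *
          ENNReal.ofReal ((1 + r) ^ (-(b * (N + ω i) / 2 : ℝ))) := fun i => by
    ext r
    have h0 := hω i
    have h1 : 0 ≤ realPoch (b * ω i / 2) (b * N / 2) :=
      div_nonneg (Real.Gamma_nonneg_of_nonneg (by positivity))
        (Real.Gamma_nonneg_of_nonneg (by positivity))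
    rw [ENNReal.ofReal_mul (by positivity)]
  simp only [hdens] at hlaw
  have hm : ∀ i : Fin N, IsProbabilityMeasure
      (betaPrimeMeasure ((b : ℝ) * ((N : ℝ) - (i : ℕ)) / 2) ((b : ℝ) * ω i / 2)) := fun i =>
    isProbabilityMeasure_betaPrimeMeasure (half_dim_pos hb0 i) (hpos i)
  have hfin : 0 < (Module.finrank ℝ K : ℝ) / 2 := by rw [hb]; positivity
  have hmain := hasLaw_detModulus_sq hD hX (h := fun _ p r => ENNReal.ofReal ((1 + r) ^ p))
    (fun _ _ => by fun_prop) (fun _ => exists_lintegral_one_add_shift hfin)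
    (p := fun i => -(b * (N + ω i) / 2 : ℝ)) hlaw hm
    (fun i => by
      rw [hb, show -(b * (N + ω i) / 2 : ℝ) + b * (i : ℕ) / 2 =
        -((b : ℝ) * ((N : ℝ) - (i : ℕ)) / 2 + b * ω i / 2) by ring]
      exact exists_betaPrimeMeasure_eq (half_dim_pos hb0 i) (hpos i))
  refine ⟨fun α hα hα' => hasLaw_sq_moment (fun ω => hD0 _) hmain (map_prod_moment hm
    (fun i => ae_pos_of_eq_smul_powerMeasure
      (exists_betaPrimeMeasure_eq (half_dim_pos hb0 i) (hpos i))) fun i => ?_), hmain⟩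
  have h := betaPrimeMeasure_moment (half_dim_pos hb0 i) (hpos i) (neg_half_dim_lt i hα) (hα' i)
  refine ⟨h.1, h.2.trans ?_⟩
  push_cast
  rfl

end Joint

/-- The row index `i : Fin N` corresponds to `l = i + 1` in the usual numbering `l = 1, …, N`.
`Measure.pi` is the joint law of independent variables with the listed laws. -/
theorem propositionR1 (F : NumberSystem) (N : ℕ)
    {Ω : Type*} [MeasurableSpace Ω] (P : Measure Ω) [IsProbabilityMeasure P]
    (X : Ω → Matrix (Fin N) (Fin N) F.Carrier)
    (hX : iIndepFun (fun (i : Fin N) (x : Ω) => (X x i : Fin N → F.Carrier)) P) :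
    -- Gaussian rows
    (∀ σ : Fin N → ℝ, (∀ i, 0 < σ i) →
      (∀ i, HasLaw (fun x => (X x i : Fin N → F.Carrier)) (F.gaussianRow N (σ i)) P) →
      (∀ α : ℂ, -(F.beta / 2 : ℝ) < α.re →
        Integrable (fun x => (F.absDet (X x) : ℂ) ^ (2 * α)) P ∧
        ∫ x, (F.absDet (X x) : ℂ) ^ (2 * α) ∂P =
          ∏ i : Fin N, ((2 * σ i ^ 2 : ℝ) : ℂ) ^ α *
            complexPoch ((F.beta : ℂ) * ((N : ℂ) - (i : ℕ)) / 2) α) ∧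
      HasLaw (fun x => F.absDet (X x) ^ 2)
        ((Measure.pi fun i : Fin N =>
            chiSquaredMeasure ((F.beta : ℝ) * (((i : ℕ) : ℝ) + 1))).map
          fun y => ∏ i, σ i ^ 2 * y i) P) ∧
    -- Beta type I rows
    (∀ ν : Fin N → ℝ, (∀ i, 0 < ν i) →
      (∀ i, HasLaw (fun x => (X x i : Fin N → F.Carrier)) (F.betaOneRow N (ν i)) P) →
      (∀ α : ℂ, -(F.beta / 2 : ℝ) < α.re →
        Integrable (fun x => (F.absDet (X x) : ℂ) ^ (2 * α)) P ∧
        ∫ x, (F.absDet (X x) : ℂ) ^ (2 * α) ∂P =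
          ∏ i : Fin N, complexPoch ((F.beta : ℂ) * ((N : ℂ) - (i : ℕ)) / 2) α /
            complexPoch ((F.beta : ℂ) * ((N : ℂ) + (ν i : ℂ)) / 2) α) ∧
      HasLaw (fun x => F.absDet (X x) ^ 2)
        ((Measure.pi fun i : Fin N =>
            betaMeasure ((F.beta : ℝ) * ((N : ℝ) - (i : ℕ)) / 2)
              ((F.beta : ℝ) * (ν i + (i : ℕ)) / 2)).map
          fun y => ∏ i, y i) P) ∧
    -- Beta type II rows
    (∀ ω : Fin N → ℝ, (∀ i, 0 < ω i) →
      (∀ i, HasLaw (fun x => (X x i : Fin N → F.Carrier)) (F.betaTwoRow N (ω i)) P) →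
      (∀ α : ℂ, -(F.beta / 2 : ℝ) < α.re → (∀ i, α.re < (F.beta : ℝ) * ω i / 2) →
        Integrable (fun x => (F.absDet (X x) : ℂ) ^ (2 * α)) P ∧
        ∫ x, (F.absDet (X x) : ℂ) ^ (2 * α) ∂P =
          ∏ i : Fin N, complexPoch ((F.beta : ℂ) * ((N : ℂ) - (i : ℕ)) / 2) α *
            complexPoch ((F.beta : ℂ) * (ω i : ℂ) / 2) (-α)) ∧
      HasLaw (fun x => F.absDet (X x) ^ 2)
        ((Measure.pi fun i : Fin N =>
            betaPrimeMeasure ((F.beta : ℝ) * ((N : ℝ) - (i : ℕ)) / 2)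
              ((F.beta : ℝ) * ω i / 2)).map
          fun y => ∏ i, y i) P) := by

  cases F with
  | real =>
    have hb : Module.finrank ℝ ℝ = NumberSystem.real.beta := Module.finrank_self ℝ
    have hD : IsDetModulus (K := ℝ) fun n => NumberSystem.absDet (N := n) .real :=
      isDetModulus_norm_det
    have hD0 : ∀ X, 0 ≤ NumberSystem.absDet (N := N) .real X := fun X => abs_nonneg _
    exact ⟨fun σ hσ hlaw => gaussianRows_law_and_moments hD hD0 hb hX σ hσ hlaw,
      fun ν hν hlaw => betaOneRows_law_and_moments hD hD0 hb hX ν hν hlaw,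
      fun ω hω hlaw => betaTwoRows_law_and_moments hD hD0 hb hX ω hω hlaw⟩
  | complex =>
    have hb : Module.finrank ℝ ℂ = NumberSystem.complex.beta := Complex.finrank_real_complex
    have hD : IsDetModulus (K := ℂ) fun n => NumberSystem.absDet (N := n) .complex :=
      isDetModulus_norm_det
    have hD0 : ∀ X, 0 ≤ NumberSystem.absDet (N := N) .complex X := fun X => norm_nonneg _
    exact ⟨fun σ hσ hlaw => gaussianRows_law_and_moments hD hD0 hb hX σ hσ hlaw,
      fun ν hν hlaw => betaOneRows_law_and_moments hD hD0 hb hX ν hν hlaw,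
      fun ω hω hlaw => betaTwoRows_law_and_moments hD hD0 hb hX ω hω hlaw⟩
  | quaternion =>
    have hb : Module.finrank ℝ ℍ[ℝ] = NumberSystem.quaternion.beta := Quaternion.finrank_eq_four
    have hD : IsDetModulus (K := ℍ[ℝ]) fun n => NumberSystem.absDet (N := n) .quaternion :=
      isDetModulus_quaternion
    have hD0 : ∀ X, 0 ≤ NumberSystem.absDet (N := N) .quaternion X := fun X => Real.sqrt_nonneg _
    exact ⟨fun σ hσ hlaw => gaussianRows_law_and_moments hD hD0 hb hX σ hσ hlaw,
      fun ν hν hlaw => betaOneRows_law_and_moments hD hD0 hb hX ν hν hlaw,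
      fun ω hω hlaw => betaTwoRows_law_and_moments hD hD0 hb hX ω hω hlaw⟩
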